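/- Let $q^{1/2}\in\mathbb C^\times$ with $q$ not a root of unity, let $[2]=(q^{-1}-q)/(q^{-1/2}+q^{1/2})$, and let $r\in\mathbb C$. **Setting.** Let $\mathcal U=U_q[osp(1|2)]$ be the superalgebra with even generators $K^{\pm1}$, odd generators $v_\pm$ and relations $KK^{-1}=K^{-1}K=1$, $Kv_\pm=q^{\pm1/2}v_\pm K$, $\{v_+,v_-\}=-(K^2-K^{-2})/(q^4-q^{-4})$, with coproduct $\Delta(K)=K\otimes K$, $\Delta(v_\pm)=v_\pm\otimes K^{-1}+K\otimes v_\pm$ and counit $\epsilon(K)=1$, $\epsilon(v_\pm)=0$. Let $V$ be its three-dimensional representation ($\ell=1$, $\lambda=0$) with basis $z_1,z_0,z_{-1}$, where $z_{\pm1}$ are even and $z_0$ is odd: $Kz_m=q^{m/2}z_m$, $v_-z_1=z_0$, $v_-z_0=-z_{-1}$, $v_-z_{-1}=0$, $v_+z_1=0$, $v_+z_0=-\kappa z_1$, $v_+z_{-1}=-\kappa z_0$, with $\kappa=(q-q^{-1})/(q^4-q^{-4})$; write $Xz_m=\sum_{m'}z_{m'}D_{m'm}(X)$. Let $\mathcal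 A=OSp_q(1|2)$ be the superalgebra of functionals on $\mathcal U$ (with the graded product dual to $\Delta$) generated by the matrix entries $T_{m'm}$, of parity $m'+m$, given by $\langle X,T_{m'm}\rangle=(-1)^{|X|(1-m')}D_{m'm}(X)$. It coacts by $\varphi(z_m)=\sum_{m'}z_{m'}\otimes T_{m'm}$, extended multiplicatively to the free superalgebra on $z_1,z_0,z_{-1}$, with values in the graded tensor product with $\mathcal A$. Put $$E^0=q^{1/2}z_{-1}z_1+z_0^2-q^{-1/2}z_1z_{-1},\qquad E^1_1=-q^{1/2}z_0z_1+q^{-1/2}z_1z_0,$$ $$E^1_0=z_{-1}z_1+(q^{-1/2}+q^{1/2})z_0^2-z_1z_{-1},\qquad E^1_{-1}=q^{1/2}z_{-1}z_0-q^{-1/2}z_0z_{-1}.$$ **Statement.** 1. In $V\otimes V$ the vectors $w$ with $Xw=\epsilon(X)w$ for all $X\in\mathcal U$ are exactly the scalar multiples of the vector corresponding to $E^0$, and the triples $(w_1,w_0,w_{-1})$ with $Xw_M=\sum_{M'}D_{M'M}(X)w_{M'}$ for all $X$ and $M$ are exactly the scalar multiples of the triple corresponding to $(E^1_1,E^1_0,E^1_{-1})$.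 Moreover $\varphi(E^0)=E^0\otimes1$ and $\varphi(E^1_M)=\sum_{M'}E^1_{M'}\otimes(-1)^{M'+M}T_{M'M}$. 2. Let $\Lambda$ be a supercommutative complex superalgebra and let $\xi\in\Lambda$ be odd. Consider the superalgebra over $\Lambda$ generated by $z_{\pm1}$ (even) and $z_0$ (odd), which supercommute with $\Lambda$, subject to the $L=0$ relation $E^0=r$ and the $L=1$ relations $E^1_M=\xi z_M$ $(M=1,0,-1)$. Call the relations consistent if (a) $E^0$, to be equated to the constant $r$, commutes with $z_1,z_0,z_{-1}$ in the superalgebra defined by the $L=1$ relations alone, and (b) any two ways of bringing a product of three generators into the order $z_{-1}^a z_0^{\varepsilon}z_1^b$ $(\varepsilon\in\{0,1\})$, by means of the reordering rules that follow from the relations, give the same result. Then the relations are consistent if and only if $\xi=0$. Also, (b) alone holds if and only if $\xi=0$, and the ordered monomials $z_{-1}^az_0^\varepsilon z_1^b$ form a basis over $\Lambda$ of the superalgebra defined by all the relations if and only if $\xi=0$. 3. For elements $z_1,z_0,z_{-1}$ of any complex algebra, the relations $E^0=r$, $E^1_1=E^1_0=E^1_{-1}=0$ are equivalent to $$z_1z_0=q\,z_0z_1,\qquad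 z_0z_{-1}=q\,z_{-1}z_0,\qquad z_1z_{-1}=q^2z_{-1}z_1-q(q^{-1/2}+q^{1/2})\,r,\qquad z_0^2=-q^{-1}[2]\,z_1z_{-1}-q^{-1}r.$$ 4. The superalgebra $P$ over $\mathbb C$ generated by $z_1,z_0,z_{-1}$ with these last relations is covariant: there is an algebra homomorphism from $P$ to the graded tensor product of $P$ and $\mathcal A$ with $z_m\mapsto\sum_{m'}z_{m'}\otimes T_{m'm}$. -/

import Mathlib

open scoped TensorProduct

noncomputable section

namespace OSpq

/-! ### Superalgebras over the complex numbers -/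

/-- A complex superalgebra: an algebra with its parity automorphism, which is `+1` on the even part
and `-1` on the odd part. -/
class SuperAlgebra (A : Type*) [Ring A] [Algebra ℂ A] where
  parity : A →ₐ[ℂ] A
  parity_parity : ∀ a, parity (parity a) = a

open SuperAlgebra

section Super

variable (A : Type*) [Ring A] [Algebra ℂ A] [SuperAlgebra A]

/-- The homogeneous part of degree `i`. -/
def part (i : ZMod 2) : Submodule ℂ A where
  carrier := {a | parity a = (-1 : ℂ) ^ i.val • a}
  add_mem' {a b} ha hb := by
    simp only [Set.mem_ofPred_eq] at *
    rw [map_add, ha, hb, smul_add]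
  zero_mem' := by simp
  smul_mem' c a ha := by
    simp only [Set.mem_ofPred_eq] at *
    rw [map_smul, ha, smul_comm]

variable {A}

theorem mem_part {i : ZMod 2} {a : A} : a ∈ part A i ↔ parity a = (-1 : ℂ) ^ i.val • a := Iff.rfl

theorem mem_part_zero {a : A} : a ∈ part A 0 ↔ parity a = a := by simp [mem_part]

theorem mem_part_one {a : A} : a ∈ part A 1 ↔ parity a = -a := by
  simp [mem_part, ZMod.val_one]

theorem neg_one_pow_val_add (i j : ZMod 2) :
    (-1 : ℂ) ^ (i + j).val = (-1) ^ i.val * (-1) ^ j.val := by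
  rw [ZMod.val_add, ← pow_add, neg_one_pow_eq_pow_mod_two (i.val + j.val)]

instance : SetLike.GradedMonoid (part A) where
  one_mem := by simp [mem_part]
  mul_mem i j a b ha hb := by
    rw [mem_part] at *
    rw [map_mul, ha, hb, neg_one_pow_val_add, smul_mul_smul_comm]

/-- The decomposition of an element into its even and its odd part. -/
def decomp (a : A) : DirectSum (ZMod 2) fun i => part A i :=
  DirectSum.of (fun i => part A i) 0 ⟨(1 / 2 : ℂ) • (a + parity a), by
      rw [mem_part_zero, map_smul, map_add, parity_parity, add_comm]⟩ +
    DirectSum.of (fun i => part A i) 1 ⟨(1 / 2 : ℂ) • (a - parity a), by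
      rw [mem_part_one, map_smul, map_sub, parity_parity, ← smul_neg, neg_sub]⟩

instance : GradedAlgebra (part A) where
  decompose' := decomp
  left_inv a := by
    simp only [decomp, map_add, DirectSum.coeAddMonoidHom_of]
    rw [← smul_add]
    have : a + parity a + (a - parity a) = (2 : ℂ) • a := by rw [two_smul]; abel
    rw [this, smul_smul]; norm_num
  right_inv x := by
    induction x using DirectSum.induction_on with
    | zero =>
      simp only [map_zero, decomp]
      rw [show (⟨(1 / 2 : ℂ) • ((0 : A) + 0), _⟩ : part A 0) = 0 from by ext; simp,
        show (⟨(1 / 2 : ℂ) • ((0 : A) - 0), _⟩ : part A 1) = 0 from by ext; simp]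
      simp
    | of i x =>
      obtain ⟨x, hx⟩ := x
      rw [DirectSum.coeAddMonoidHom_of]
      fin_cases i
      · have h : parity x = x := mem_part_zero.1 hx
        simp only [decomp]
        rw [show (⟨(1 / 2 : ℂ) • (x + parity x), _⟩ : part A 0) = ⟨x, hx⟩ from by
            ext; simp only [h]; rw [← two_smul ℂ x, smul_smul]; norm_num,
          show (⟨(1 / 2 : ℂ) • (x - parity x), _⟩ : part A 1) = 0 from by
            ext; simp [h], map_zero, add_zero]
        rfl
      · have h : parity x = -x := mem_part_one.1 hx
        simp only [decomp]
        rw [show (⟨(1 / 2 : ℂ) • (x - parity x), _⟩ : part A 1) = ⟨x, hx⟩ from by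
            ext; simp only [h, sub_neg_eq_add]; rw [← two_smul ℂ x, smul_smul]; norm_num,
          show (⟨(1 / 2 : ℂ) • (x + parity x), _⟩ : part A 0) = 0 from by
            ext; simp [h], map_zero, zero_add]
        rfl
    | add x y hx hy =>
      have key : ∀ a b : A, decomp (a + b) = decomp a + decomp b := by
        intro a b
        simp only [decomp]
        rw [add_add_add_comm, ← map_add, ← map_add]
        congr 2
        · ext; simp only [map_add, Submodule.coe_add]; rw [← smul_add]; congr 1; abel
        · ext; simp only [map_add, Submodule.coe_add]; rw [← smul_add]; congr 1; abel
      rw [map_add, key, hx, hy]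

end Super

end OSpq

namespace OSpq

open SuperAlgebra

section Quotients

variable {X : Type*} (s : X → ℕ)

/-- The parity automorphism of the free algebra whose generator `x` has parity `s x`. -/
def freeParity : FreeAlgebra ℂ X →ₐ[ℂ] FreeAlgebra ℂ X :=
  FreeAlgebra.lift ℂ fun x => (-1 : ℂ) ^ s x • FreeAlgebra.ι ℂ x

@[simp] theorem freeParity_ι (x : X) :
    freeParity s (FreeAlgebra.ι ℂ x) = (-1 : ℂ) ^ s x • FreeAlgebra.ι ℂ x := by
  simp [freeParity]

theorem freeParity_freeParity (a : FreeAlgebra ℂ X) : freeParity s (freeParity s a) = a := by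
  have : (freeParity s).comp (freeParity s) = AlgHom.id ℂ _ := by
    ext x
    simp [smul_smul, ← mul_pow]
  exact DFunLike.congr_fun this a

/-- The parity automorphism of a quotient of a free superalgebra by relations that are stable under
parity. -/
def quotientParity (rel : FreeAlgebra ℂ X → FreeAlgebra ℂ X → Prop)
    (h : ∀ ⦃a b⦄, rel a b → RingQuot.mkAlgHom ℂ rel (freeParity s a) =
      RingQuot.mkAlgHom ℂ rel (freeParity s b)) : RingQuot rel →ₐ[ℂ] RingQuot rel :=
  RingQuot.liftAlgHom ℂ ⟨(RingQuot.mkAlgHom ℂ rel).comp (freeParity s), fun _ _ hab => h hab⟩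

theorem quotientParity_mk (rel : FreeAlgebra ℂ X → FreeAlgebra ℂ X → Prop) (h)
    (a : FreeAlgebra ℂ X) : quotientParity s rel h (RingQuot.mkAlgHom ℂ rel a) =
      RingQuot.mkAlgHom ℂ rel (freeParity s a) := by
  exact RingQuot.liftAlgHom_mkAlgHom_apply ℂ ((RingQuot.mkAlgHom ℂ rel).comp (freeParity s))
    (fun _ _ hab => h hab) a

/-- A quotient of a free superalgebra by relations that are stable under parity is again a
superalgebra. -/
@[reducible] def quotientSuper (rel : FreeAlgebra ℂ X → FreeAlgebra ℂ X → Prop)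
    (h : ∀ ⦃a b⦄, rel a b → RingQuot.mkAlgHom ℂ rel (freeParity s a) =
      RingQuot.mkAlgHom ℂ rel (freeParity s b)) : SuperAlgebra (RingQuot rel) where
  parity := quotientParity s rel h
  parity_parity a := by
    obtain ⟨a, rfl⟩ := RingQuot.mkAlgHom_surjective ℂ rel a
    rw [quotientParity_mk, quotientParity_mk, freeParity_freeParity]

end Quotients

/-! ### The index set of the coordinates

`SignType` is the set of weights `{-1, 0, 1}` of the three dimensional representation. -/

/-- The parity of the basis vector of weight `m` (with an even highest weight vector). -/
def par : SignType → ℕ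
  | 0 => 1
  | _ => 0

/-! ### The quantum superalgebra `U_q[osp(1|2)]`; the parameter is `p = q^{1/2}` -/

inductive UGen
  | K
  | Kinv
  | vp
  | vm

def UGen.par : UGen → ℕ
  | .K => 0
  | .Kinv => 0
  | .vp => 1
  | .vm => 1

open FreeAlgebra in
inductive URel (p : ℂˣ) : FreeAlgebra ℂ UGen → FreeAlgebra ℂ UGen → Prop
  | K_Kinv : URel p (ι ℂ .K * ι ℂ .Kinv) 1
  | Kinv_K : URel p (ι ℂ .Kinv * ι ℂ .K) 1
  | K_vp : URel p (ι ℂ .K * ι ℂ .vp) ((p : ℂ) • (ι ℂ .vp * ι ℂ .K))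
  | K_vm : URel p (ι ℂ .K * ι ℂ .vm) ((p : ℂ)⁻¹ • (ι ℂ .vm * ι ℂ .K))
  | vp_vm : URel p (ι ℂ .vp * ι ℂ .vm + ι ℂ .vm * ι ℂ .vp)
      (-(((p : ℂ) ^ 8 - ((p : ℂ) ^ 8)⁻¹)⁻¹ • (ι ℂ .K ^ 2 - ι ℂ .Kinv ^ 2)))

/-- The algebra `U_q[osp(1|2)]`. -/
abbrev U (p : ℂˣ) : Type := RingQuot (URel p)

namespace U

variable (p : ℂˣ)

def gen (g : UGen) : U p := RingQuot.mkAlgHom ℂ (URel p) (FreeAlgebra.ι ℂ g)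

instance : SuperAlgebra (U p) := quotientSuper UGen.par (URel p) <| by
  intro a b h
  have h' := RingQuot.mkAlgHom_rel ℂ h
  cases h <;> simp [UGen.par] at h' ⊢
  all_goals exact h'

variable {p}

theorem K_Kinv : gen p .K * gen p .Kinv = 1 := by
  simpa [gen] using RingQuot.mkAlgHom_rel ℂ (URel.K_Kinv (p := p))

theorem Kinv_K : gen p .Kinv * gen p .K = 1 := by
  simpa [gen] using RingQuot.mkAlgHom_rel ℂ (URel.Kinv_K (p := p))

theorem K_vp : gen p .K * gen p .vp = (p : ℂ) • (gen p .vp * gen p .K) := by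
  simpa [gen] using RingQuot.mkAlgHom_rel ℂ (URel.K_vp (p := p))

theorem K_vm : gen p .K * gen p .vm = (p : ℂ)⁻¹ • (gen p .vm * gen p .K) := by
  simpa [gen] using RingQuot.mkAlgHom_rel ℂ (URel.K_vm (p := p))

theorem vp_vm : gen p .vp * gen p .vm + gen p .vm * gen p .vp =
    -(((p : ℂ) ^ 8 - ((p : ℂ) ^ 8)⁻¹)⁻¹ • (gen p .K ^ 2 - gen p .Kinv ^ 2)) := by
  simpa [gen] using RingQuot.mkAlgHom_rel ℂ (URel.vp_vm (p := p))

/-- The universal property of `U_q[osp(1|2)]`. -/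
def lift {B : Type*} [Ring B] [Algebra ℂ B] (f : UGen → B)
    (h1 : f .K * f .Kinv = 1) (h2 : f .Kinv * f .K = 1)
    (h3 : f .K * f .vp = (p : ℂ) • (f .vp * f .K))
    (h4 : f .K * f .vm = (p : ℂ)⁻¹ • (f .vm * f .K))
    (h5 : f .vp * f .vm + f .vm * f .vp =
      -(((p : ℂ) ^ 8 - ((p : ℂ) ^ 8)⁻¹)⁻¹ • (f .K ^ 2 - f .Kinv ^ 2))) : U p →ₐ[ℂ] B :=
  RingQuot.liftAlgHom ℂ ⟨FreeAlgebra.lift ℂ f, by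
    intro a b h
    cases h <;> simp [h1, h2, h3, h4]
    simpa using h5⟩

@[simp] theorem lift_gen {B : Type*} [Ring B] [Algebra ℂ B] (f : UGen → B) (h1 h2 h3 h4 h5)
    (g : UGen) : lift (p := p) f h1 h2 h3 h4 h5 (gen p g) = f g := by
  simp [lift, gen]

theorem hom_ext {B : Type*} [Ring B] [Algebra ℂ B] {f g : U p →ₐ[ℂ] B}
    (h : ∀ x, f (gen p x) = g (gen p x)) : f = g := by
  apply RingQuot.ringQuot_ext'
  ext x
  exact h x

@[elab_as_elim]
theorem induction {P : U p → Prop} (gen : ∀ g, P (gen p g)) (scalar : ∀ c, P (algebraMap ℂ _ c))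
    (add : ∀ x y, P x → P y → P (x + y)) (mul : ∀ x y, P x → P y → P (x * y)) (X : U p) : P X := by
  obtain ⟨a, rfl⟩ := RingQuot.mkAlgHom_surjective ℂ (URel p) X
  induction a using FreeAlgebra.induction with
  | grade0 c => rw [AlgHom.commutes]; exact scalar c
  | grade1 g => exact gen g
  | mul x y hx hy => rw [map_mul]; exact mul _ _ hx hy
  | add x y hx hy => rw [map_add]; exact add _ _ hx hy

theorem parity_gen (g : UGen) : parity (gen p g) = (-1 : ℂ) ^ g.par • gen p g := by
  rw [gen]
  exact (quotientParity_mk UGen.par (URel p) _ _).trans (by rw [freeParity_ι, map_smul])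

end U

section Tensor

variable {A B : Type*} [Ring A] [Algebra ℂ A] [SuperAlgebra A] [Ring B] [Algebra ℂ B]
  [SuperAlgebra B]

open GradedTensorProduct

theorem tmul_mul_tmul_even_left (a a' : A) (b b' : B) (hb : parity b = b) :
    (a ᵍ⊗ₜ[ℂ] b * a' ᵍ⊗ₜ[ℂ] b' : part A ᵍ⊗[ℂ] part B) = (a * a') ᵍ⊗ₜ[ℂ] (b * b') := by
  have key : ∀ (i : ZMod 2) (x : part A i),
      (a ᵍ⊗ₜ[ℂ] b * (x : A) ᵍ⊗ₜ[ℂ] b' : part A ᵍ⊗[ℂ] part B) = (a * x) ᵍ⊗ₜ[ℂ] (b * b') :=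
    fun i x => tmul_zero_coe_mul_coe_tmul (part A) (part B) a ⟨b, mem_part_zero.2 hb⟩ x b'
  induction a' using DirectSum.Decomposition.inductionOn (part A) with
  | zero => simp [tmul]
  | homogeneous x => exact key _ x
  | add x y hx hy =>
    simp only [tmul, TensorProduct.add_tmul, map_add, mul_add] at *
    rw [hx, hy]

theorem tmul_mul_tmul_even_right (a a' : A) (b b' : B) (ha : parity a' = a') :
    (a ᵍ⊗ₜ[ℂ] b * a' ᵍ⊗ₜ[ℂ] b' : part A ᵍ⊗[ℂ] part B) = (a * a') ᵍ⊗ₜ[ℂ] (b * b') := by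
  have key : ∀ (i : ZMod 2) (x : part B i),
      (a ᵍ⊗ₜ[ℂ] (x : B) * a' ᵍ⊗ₜ[ℂ] b' : part A ᵍ⊗[ℂ] part B) = (a * a') ᵍ⊗ₜ[ℂ] (x * b') :=
    fun i x => tmul_coe_mul_zero_coe_tmul (part A) (part B) a x ⟨a', mem_part_zero.2 ha⟩ b'
  induction b using DirectSum.Decomposition.inductionOn (part B) with
  | zero => simp [tmul]
  | homogeneous x => exact key _ x
  | add x y hx hy =>
    simp only [tmul, TensorProduct.tmul_add, map_add, add_mul] at *
    rw [hx, hy]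

theorem tmul_mul_tmul_odd (a a' : A) (b b' : B) (ha : parity a' = -a') (hb : parity b = -b) :
    (a ᵍ⊗ₜ[ℂ] b * a' ᵍ⊗ₜ[ℂ] b' : part A ᵍ⊗[ℂ] part B) = -((a * a') ᵍ⊗ₜ[ℂ] (b * b')) := by
  have := tmul_coe_mul_coe_tmul (part A) (part B) a ⟨b, mem_part_one.2 hb⟩
    ⟨a', mem_part_one.2 ha⟩ b'
  rw [this]
  have h : (-1 : ℤˣ) ^ ((1 : ZMod 2) * 1) = -1 := by decide
  rw [h]
  simp

/-- The tensor product of the parity automorphisms. -/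
def parityTensor : (part A ᵍ⊗[ℂ] part B) →ₐ[ℂ] (part A ᵍ⊗[ℂ] part B) :=
  GradedTensorProduct.lift (part A) (part B) ((includeLeft (part A) (part B)).comp parity)
    ((includeRight (part A) (part B)).comp parity) (by
      rintro i j ⟨a, ha⟩ ⟨b, hb⟩
      have h := tmul_coe_mul_coe_tmul (part A) (part B) 1 ⟨b, hb⟩ ⟨a, ha⟩ 1
      simp only [one_mul, mul_one] at h
      simp only [AlgHom.comp_apply, includeLeft_apply, includeRight_apply]
      rw [mem_part.1 ha, mem_part.1 hb]
      simp only [tmul, ← TensorProduct.smul_tmul', TensorProduct.tmul_smul, map_smul] at h ⊢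
      rw [smul_mul_smul_comm, smul_mul_smul_comm, h, smul_comm, mul_comm ((-1 : ℂ) ^ j.val)]
      congr 1
      have := tmul_one_mul_one_tmul (part A) (part B) a b
      simp only [tmul] at this
      rw [this, smul_smul, Int.units_mul_self, one_smul])

theorem parityTensor_tmul (a : A) (b : B) :
    parityTensor (a ᵍ⊗ₜ[ℂ] b : part A ᵍ⊗[ℂ] part B) = parity a ᵍ⊗ₜ[ℂ] parity b := by
  rw [parityTensor, lift_tmul]
  exact tmul_one_mul_one_tmul (part A) (part B) (parity a) (parity b)

end Tensor

end OSpq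

namespace OSpq

open SuperAlgebra

theorem sum_sign {M : Type*} [AddCommMonoid M] (f : SignType → M) :
    ∑ i, f i = f 1 + f 0 + f (-1) := by
  have : (Finset.univ : Finset SignType) = {1, 0, -1} := by decide
  rw [this, Finset.sum_insert (by decide), Finset.sum_insert (by decide), Finset.sum_singleton,
    add_assoc]

section Structure

variable (p : ℂˣ)

open U GradedTensorProduct

/-- The coproduct: `Δ(K) = K ⊗ K` and `Δ(v) = v ⊗ K⁻¹ + K ⊗ v` for `v = v₊, v₋`. -/
def coprodGen : UGen → part (U p) ᵍ⊗[ℂ] part (U p)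
  | .K => gen p .K ᵍ⊗ₜ[ℂ] gen p .K
  | .Kinv => gen p .Kinv ᵍ⊗ₜ[ℂ] gen p .Kinv
  | .vp => gen p .vp ᵍ⊗ₜ[ℂ] gen p .Kinv + gen p .K ᵍ⊗ₜ[ℂ] gen p .vp
  | .vm => gen p .vm ᵍ⊗ₜ[ℂ] gen p .Kinv + gen p .K ᵍ⊗ₜ[ℂ] gen p .vm

variable {p}

theorem parity_K : parity (gen p .K) = gen p .K := by simp [parity_gen, UGen.par]
theorem parity_Kinv : parity (gen p .Kinv) = gen p .Kinv := by simp [parity_gen, UGen.par]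
theorem parity_vp : parity (gen p .vp) = -gen p .vp := by
  rw [parity_gen, UGen.par, pow_one]; exact neg_one_smul ℂ (gen p _)
theorem parity_vm : parity (gen p .vm) = -gen p .vm := by
  rw [parity_gen, UGen.par, pow_one]; exact neg_one_smul ℂ (gen p _)

theorem Kinv_vp : gen p .vp * gen p .Kinv = (p : ℂ) • (gen p .Kinv * gen p .vp) := by
  calc gen p .vp * gen p .Kinv = gen p .Kinv * (gen p .K * gen p .vp) * gen p .Kinv := by
        rw [← mul_assoc (gen p .Kinv), Kinv_K, one_mul]
    _ = _ := by
        rw [K_vp, mul_smul_comm, smul_mul_assoc, ← mul_assoc, mul_assoc _ (gen p .K), K_Kinv,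
          mul_one]

theorem Kinv_vm : gen p .vm * gen p .Kinv = (p : ℂ)⁻¹ • (gen p .Kinv * gen p .vm) := by
  calc gen p .vm * gen p .Kinv = gen p .Kinv * (gen p .K * gen p .vm) * gen p .Kinv := by
        rw [← mul_assoc (gen p .Kinv), Kinv_K, one_mul]
    _ = _ := by
        rw [K_vm, mul_smul_comm, smul_mul_assoc, ← mul_assoc, mul_assoc _ (gen p .K), K_Kinv,
          mul_one]

theorem coprod_aux (v : UGen) (c : ℂ) (h : gen p .K * gen p v = c • (gen p v * gen p .K)) :
    (gen p .K ᵍ⊗ₜ[ℂ] gen p .K : part (U p) ᵍ⊗[ℂ] part (U p)) *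
      (gen p v ᵍ⊗ₜ[ℂ] gen p .Kinv + gen p .K ᵍ⊗ₜ[ℂ] gen p v) =
    c • ((gen p v ᵍ⊗ₜ[ℂ] gen p .Kinv + gen p .K ᵍ⊗ₜ[ℂ] gen p v) *
      (gen p .K ᵍ⊗ₜ[ℂ] gen p .K)) := by
  rw [mul_add, add_mul, smul_add, tmul_mul_tmul_even_left _ _ _ _ parity_K,
    tmul_mul_tmul_even_left _ _ _ _ parity_K, tmul_mul_tmul_even_right _ _ _ _ parity_K,
    tmul_mul_tmul_even_right _ _ _ _ parity_K, h, K_Kinv, Kinv_K]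
  simp only [tmul, ← TensorProduct.smul_tmul', TensorProduct.tmul_smul, map_smul]

theorem coprod_vp_vm : coprodGen p .vp * coprodGen p .vm + coprodGen p .vm * coprodGen p .vp =
    -(((p : ℂ) ^ 8 - ((p : ℂ) ^ 8)⁻¹)⁻¹ • (coprodGen p .K ^ 2 - coprodGen p .Kinv ^ 2)) := by
  have hp : (p : ℂ) ≠ 0 := p.ne_zero
  simp only [coprodGen, pow_two]
  simp only [mul_add, add_mul]
  rw [tmul_mul_tmul_even_left _ _ _ _ parity_Kinv, tmul_mul_tmul_even_left _ _ _ _ parity_Kinv,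
    tmul_mul_tmul_even_left _ _ _ _ parity_Kinv, tmul_mul_tmul_even_left _ _ _ _ parity_Kinv,
    tmul_mul_tmul_even_left _ _ _ _ parity_Kinv, tmul_mul_tmul_even_left _ _ _ _ parity_K,
    tmul_mul_tmul_even_right _ _ _ _ parity_K, tmul_mul_tmul_even_right _ _ _ _ parity_K,
    tmul_mul_tmul_odd _ _ _ _ parity_vm parity_vp, tmul_mul_tmul_odd _ _ _ _ parity_vp parity_vm,
    K_vp, K_vm, Kinv_vp, Kinv_vm]
  have e1 : ∀ x y : U p, ((p : ℂ) • x) ᵍ⊗ₜ[ℂ] ((p : ℂ)⁻¹ • y) =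
      (x ᵍ⊗ₜ[ℂ] y : part (U p) ᵍ⊗[ℂ] part (U p)) := by
    intro x y
    simp only [tmul, ← TensorProduct.smul_tmul', TensorProduct.tmul_smul, map_smul, smul_smul]
    rw [inv_mul_cancel₀ hp, one_smul]
  have e2 : ∀ x y : U p, ((p : ℂ)⁻¹ • x) ᵍ⊗ₜ[ℂ] ((p : ℂ) • y) =
      (x ᵍ⊗ₜ[ℂ] y : part (U p) ᵍ⊗[ℂ] part (U p)) := by
    intro x y
    simp only [tmul, ← TensorProduct.smul_tmul', TensorProduct.tmul_smul, map_smul, smul_smul]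
    rw [mul_inv_cancel₀ hp, one_smul]
  rw [e1, e2]
  have h := vp_vm (p := p)
  generalize ((p : ℂ) ^ 8 - ((p : ℂ) ^ 8)⁻¹)⁻¹ = k at h ⊢
  have h1 : gen p .vp * gen p .vm =
      -(k • (gen p .K ^ 2 - gen p .Kinv ^ 2)) - gen p .vm * gen p .vp := by
    rw [← h]; abel
  rw [h1]
  simp only [tmul, TensorProduct.sub_tmul, TensorProduct.tmul_sub, TensorProduct.neg_tmul,
    TensorProduct.tmul_neg, ← TensorProduct.smul_tmul', TensorProduct.tmul_smul, map_sub, map_neg,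
    map_smul, pow_two]
  module

variable (p)

/-- The coproduct of `U_q[osp(1|2)]`. -/
def coprod : U p →ₐ[ℂ] part (U p) ᵍ⊗[ℂ] part (U p) :=
  U.lift (coprodGen p)
    (by
      simp only [coprodGen]
      rw [tmul_mul_tmul_even_left _ _ _ _ parity_K, K_Kinv]; rfl)
    (by
      simp only [coprodGen]
      rw [tmul_mul_tmul_even_left _ _ _ _ parity_Kinv, Kinv_K]; rfl)
    (coprod_aux .vp _ K_vp)
    (coprod_aux .vm _ K_vm)
    coprod_vp_vm

/-- The counit of `U_q[osp(1|2)]`. -/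
def counit : U p →ₐ[ℂ] ℂ :=
  U.lift (fun | .K => 1 | .Kinv => 1 | .vp => 0 | .vm => 0) (by simp) (by simp) (by simp)
    (by simp) (by simp)

/-- The generators in the representation with `ℓ = 1`, `λ = 0`:
`K e_m = q^{m/2} e_m`, `v₋ e_1 = e_0`, `v₋ e_0 = -e_{-1}`,
`v₊ e_0 = -κ e_1`, `v₊ e_{-1} = -κ e_0` with `κ = (q - q⁻¹) / (q⁴ - q⁻⁴)`.
The `(m', m)` entry is the coefficient of `e_{m'}` in the image of `e_m`. -/
def repGen : UGen → Matrix SignType SignType ℂ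
  | .K => Matrix.diagonal fun m => (p : ℂ) ^ (m : ℤ)
  | .Kinv => Matrix.diagonal fun m => (p : ℂ) ^ (-(m : ℤ))
  | .vm => Matrix.of fun i j =>
      match i, j with
      | .zero, .pos => 1
      | .neg, .zero => -1
      | _, _ => 0
  | .vp => Matrix.of fun i j =>
      match i, j with
      | .pos, .zero => -(((p : ℂ) ^ 2 - ((p : ℂ) ^ 2)⁻¹) / ((p : ℂ) ^ 8 - ((p : ℂ) ^ 8)⁻¹))
      | .zero, .neg => -(((p : ℂ) ^ 2 - ((p : ℂ) ^ 2)⁻¹) / ((p : ℂ) ^ 8 - ((p : ℂ) ^ 8)⁻¹))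
      | _, _ => 0

/-- The representation `D` of `U_q[osp(1|2)]` with `ℓ = 1`, `λ = 0`. -/
def rep : U p →ₐ[ℂ] Matrix SignType SignType ℂ :=
  U.lift (repGen p)
    (by
      have hp : (p : ℂ) ≠ 0 := p.ne_zero
      ext i j; cases i <;> cases j <;> simp [repGen, hp])
    (by
      have hp : (p : ℂ) ≠ 0 := p.ne_zero
      ext i j; cases i <;> cases j <;> simp [repGen, hp])
    (by
      have hp : (p : ℂ) ≠ 0 := p.ne_zero
      ext i j; cases i <;> cases j <;> simp [repGen, hp, mul_comm])
    (by
      have hp : (p : ℂ) ≠ 0 := p.ne_zero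
      ext i j; cases i <;> cases j <;> simp [repGen, hp, mul_comm])
    (by
      have hp : (p : ℂ) ≠ 0 := p.ne_zero
      ext i j
      cases i <;> cases j <;>
        simp [repGen, Matrix.mul_apply, sum_sign, pow_two, Matrix.diagonal, div_eq_mul_inv] <;>
        ring)

theorem coprod_gen (g : UGen) : coprod p (gen p g) = coprodGen p g := U.lift_gen ..

theorem rep_gen (g : UGen) : rep p (gen p g) = repGen p g := U.lift_gen ..

end Structure

end OSpq

namespace OSpq

open SuperAlgebra

/-! ### The quantum supergroup `OSp_q(1|2)` as the dual of `U_q[osp(1|2)]` -/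

section Dual

variable (p : ℂˣ)

/-- The product of functionals on `U_q[osp(1|2)]` that is dual to the coproduct: if `f` has parity
`n`, then `⟨X, f g⟩ = ∑ (-1)^(n |X₂|) ⟨X₁, f⟩ ⟨X₂, g⟩`, where `Δ(X) = ∑ X₁ ⊗ X₂`. -/
def conv (n : ℕ) (f g : U p →ₗ[ℂ] ℂ) : U p →ₗ[ℂ] ℂ :=
  LinearMap.mul' ℂ ℂ ∘ₗ TensorProduct.map f (g ∘ₗ ((parity : U p →ₐ[ℂ] U p) ^ n).toLinearMap) ∘ₗ
    (GradedTensorProduct.of ℂ (part (U p)) (part (U p))).symm.toLinearMap ∘ₗ (coprod p).toLinearMap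

/-- The functional `⟨·, T_{m'm}⟩`, that is
`⟨X, T_{m'm}⟩ = (-1)^(|X| (1 - m')) D_{m'm}(X)`. -/
def matrixCoeff (m' m : SignType) : U p →ₗ[ℂ] ℂ :=
  Matrix.entryLinearMap ℂ ℂ m' m ∘ₗ (rep p).toLinearMap ∘ₗ
    ((parity : U p →ₐ[ℂ] U p) ^ par m').toLinearMap

/-- Left multiplication by `T_{m'm}`, an element of parity `m' + m`, on functionals. -/
def convLeft (t : SignType × SignType) : Module.End ℂ (U p →ₗ[ℂ] ℂ) where
  toFun g := conv p (par t.1 + par t.2) (matrixCoeff p t.1 t.2) g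
  map_add' g h := by
    ext X
    simp only [conv, LinearMap.add_comp, TensorProduct.map_add_right, LinearMap.comp_add,
      LinearMap.add_apply]
  map_smul' c g := by
    ext X
    simp only [conv, LinearMap.smul_comp, TensorProduct.map_smul_right, LinearMap.comp_smul,
      LinearMap.smul_apply, RingHom.id_apply]

/-- The functional on `U_q[osp(1|2)]` given by a noncommutative polynomial in the matrix entries
`T_{m'm}`; the empty monomial is the counit. -/
def pairing (f : FreeAlgebra ℂ (SignType × SignType)) : U p →ₗ[ℂ] ℂ :=
  FreeAlgebra.lift ℂ (convLeft p) f (counit p).toLinearMap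

/-- Two polynomials in the matrix entries are identified if they agree as functionals. -/
def ARel (f g : FreeAlgebra ℂ (SignType × SignType)) : Prop :=
  ∀ X : U p, pairing p f X = pairing p g X

/-- The algebra `OSp_q(1|2)`, generated by the entries of `T = T^{(1)}(0)` inside the dual of
`U_q[osp(1|2)]`. -/
abbrev A : Type := RingQuot (ARel p)

/-- The entry `T_{m'm}` of the corepresentation matrix `T^{(1)}(0)`. -/
def A.T (m' m : SignType) : A p := RingQuot.mkAlgHom ℂ (ARel p) (FreeAlgebra.ι ℂ (m', m))

theorem coprod_parity (X : U p) : coprod p (parity X) = parityTensor (coprod p X) := by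
  have : (coprod p).comp parity = parityTensor.comp (coprod p) := by
    apply U.hom_ext
    intro g
    have hK : parityTensor (coprodGen p .K) = coprodGen p .K := by
      simp only [coprodGen, parityTensor_tmul, parity_K]
    have hKi : parityTensor (coprodGen p .Kinv) = coprodGen p .Kinv := by
      simp only [coprodGen, parityTensor_tmul, parity_Kinv]
    have hvp : parityTensor (coprodGen p .vp) = -coprodGen p .vp := by
      simp only [coprodGen, map_add, parityTensor_tmul, parity_K, parity_Kinv, parity_vp,
        GradedTensorProduct.tmul, TensorProduct.neg_tmul, TensorProduct.tmul_neg, map_neg]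
      abel
    have hvm : parityTensor (coprodGen p .vm) = -coprodGen p .vm := by
      simp only [coprodGen, map_add, parityTensor_tmul, parity_K, parity_Kinv, parity_vm,
        GradedTensorProduct.tmul, TensorProduct.neg_tmul, TensorProduct.tmul_neg, map_neg]
      abel
    cases g
    · simp only [AlgHom.comp_apply, parity_K, coprod_gen, hK]
    · simp only [AlgHom.comp_apply, parity_Kinv, coprod_gen, hKi]
    · simp only [AlgHom.comp_apply, parity_vp, map_neg, coprod_gen, hvp]
    · simp only [AlgHom.comp_apply, parity_vm, map_neg, coprod_gen, hvm]
  exact DFunLike.congr_fun this X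

theorem counit_parity (X : U p) : counit p (parity X) = counit p X := by
  have : (counit p).comp parity = counit p := by
    apply U.hom_ext
    intro g
    cases g <;> simp [parity_K, parity_Kinv, parity_vp, parity_vm, counit]
  exact DFunLike.congr_fun this X

theorem rep_parity (X : U p) (i j : SignType) :
    rep p (parity X) i j = (-1) ^ (par i + par j) * rep p X i j := by
  induction X using U.induction generalizing i j with
  | gen g =>
    cases g <;> simp [parity_K, parity_Kinv, parity_vp, parity_vm, rep_gen] <;>
      cases i <;> cases j <;> simp [repGen, par]
  | scalar c =>
    rw [AlgHom.commutes, AlgHom.commutes, Matrix.algebraMap_matrix_apply]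
    split_ifs with h
    · subst h; rw [← two_mul, pow_mul]; simp
    · simp
  | add x y hx hy => simp [hx, hy, mul_add]
  | mul x y hx hy =>
    simp only [map_mul, Matrix.mul_apply, hx, hy, Finset.mul_sum]
    refine Finset.sum_congr rfl fun k _ => ?_
    have : ((-1 : ℂ) ^ par k) * (-1) ^ par k = 1 := by rw [← mul_pow]; simp
    rw [pow_add, pow_add, pow_add]
    linear_combination (-1 : ℂ) ^ par i * (-1) ^ par j * rep p x i k * rep p y k j * this

theorem parity_pow_comm (n : ℕ) (X : U p) : ((parity : U p →ₐ[ℂ] U p) ^ n) (parity X) =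
    parity (((parity : U p →ₐ[ℂ] U p) ^ n) X) := by
  change ((parity ^ n * parity : U p →ₐ[ℂ] U p)) X = (parity * parity ^ n : U p →ₐ[ℂ] U p) X
  rw [← pow_succ, ← pow_succ']

theorem matrixCoeff_parity (t : SignType × SignType) (X : U p) :
    matrixCoeff p t.1 t.2 (parity X) =
      (-1) ^ (par t.1 + par t.2) * matrixCoeff p t.1 t.2 X := by
  simp only [matrixCoeff, LinearMap.comp_apply, AlgHom.toLinearMap_apply, parity_pow_comm,
    Matrix.entryLinearMap_apply, rep_parity]

theorem convLeft_parity (t : SignType × SignType) (g : U p →ₗ[ℂ] ℂ) :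
    convLeft p t (g ∘ₗ parity.toLinearMap) =
      (-1 : ℂ) ^ (par t.1 + par t.2) • (convLeft p t g ∘ₗ parity.toLinearMap) := by
  ext X
  simp only [convLeft, LinearMap.coe_mk, AddHom.coe_mk, conv, LinearMap.comp_apply,
    AlgHom.toLinearMap_apply, LinearMap.smul_apply, coprod_parity, LinearEquiv.coe_coe]
  obtain ⟨Z, hZ⟩ := (GradedTensorProduct.of ℂ (part (U p)) (part (U p))).surjective (coprod p X)
  rw [← hZ]
  clear hZ
  induction Z using TensorProduct.induction_on with
  | zero => simp only [map_zero, smul_zero]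
  | add x y hx hy => simp only [map_add, smul_add, hx, hy]
  | tmul x y =>
    have hs : ((-1 : ℂ) ^ (par t.1 + par t.2)) * (-1) ^ (par t.1 + par t.2) = 1 := by
      rw [← mul_pow]; simp
    rw [parityTensor_tmul, GradedTensorProduct.tmul, GradedTensorProduct.of_symm_of,
      GradedTensorProduct.of_symm_of, TensorProduct.map_tmul, TensorProduct.map_tmul,
      LinearMap.mul'_apply, LinearMap.mul'_apply, matrixCoeff_parity]
    simp only [LinearMap.comp_apply, AlgHom.toLinearMap_apply, parity_pow_comm, smul_eq_mul]
    rw [← mul_assoc, ← mul_assoc, hs, one_mul]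

/-- The parity of the entry `T_{m'm}`. -/
def parT (t : SignType × SignType) : ℕ := par t.1 + par t.2

theorem pairing_parity (f : FreeAlgebra ℂ (SignType × SignType)) :
    pairing p (freeParity parT f) = pairing p f ∘ₗ parity.toLinearMap := by
  have key : ∀ φ : U p →ₗ[ℂ] ℂ, FreeAlgebra.lift ℂ (convLeft p) (freeParity parT f)
      (φ ∘ₗ parity.toLinearMap) =
        FreeAlgebra.lift ℂ (convLeft p) f φ ∘ₗ parity.toLinearMap := by
    induction f using FreeAlgebra.induction with
    | grade0 c =>
      intro φ
      rw [AlgHom.commutes, AlgHom.commutes, Module.algebraMap_end_apply,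
        Module.algebraMap_end_apply, LinearMap.smul_comp]
    | grade1 t =>
      intro φ
      rw [freeParity_ι, map_smul, FreeAlgebra.lift_ι_apply, LinearMap.smul_apply, convLeft_parity,
        smul_smul, parT, ← mul_pow]
      simp
    | mul x y hx hy =>
      intro φ
      rw [map_mul, map_mul, map_mul, Module.End.mul_apply, Module.End.mul_apply, hy, hx]
    | add x y hx hy =>
      intro φ
      rw [map_add, map_add, map_add, LinearMap.add_apply, LinearMap.add_apply, hy, hx,
        LinearMap.add_comp]
  have h := key (counit p).toLinearMap
  have hc : (counit p).toLinearMap ∘ₗ (parity : U p →ₐ[ℂ] U p).toLinearMap =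
      (counit p).toLinearMap := by
    ext X; exact counit_parity p X
  rw [hc] at h
  exact h

instance : SuperAlgebra (A p) := quotientSuper parT (ARel p) <| by
  intro f g h
  apply RingQuot.mkAlgHom_rel
  intro X
  rw [pairing_parity, pairing_parity]
  exact h (parity X)

end Dual

end OSpq

namespace OSpq

open SuperAlgebra

/-! ### The tensor square of the representation and the coupled bases -/

section Coupling

variable (p : ℂˣ)

/-- The tensor square of the representation `rep p`, the entry `((i', j'), (i, j))` being the
coefficient of `e_{i'} ⊗ e_{j'}` in the image of `e_i ⊗ e_j`; it uses the sign rule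
`(x ⊗ y) (e_i ⊗ e_j) = (-1)^(|y| |e_i|) x e_i ⊗ y e_j`. -/
def tensorRep (X : U p) : Matrix (SignType × SignType) (SignType × SignType) ℂ :=
  Matrix.of fun k' k =>
    LinearMap.mul' ℂ ℂ (TensorProduct.map
      (Matrix.entryLinearMap ℂ ℂ k'.1 k.1 ∘ₗ (rep p).toLinearMap)
      (Matrix.entryLinearMap ℂ ℂ k'.2 k.2 ∘ₗ (rep p).toLinearMap ∘ₗ
        ((parity : U p →ₐ[ℂ] U p) ^ par k.1).toLinearMap)
      ((GradedTensorProduct.of ℂ (part (U p)) (part (U p))).symm (coprod p X)))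

open scoped Matrix in
/-- The vector with coefficients `C` in the tensor square spans the component `L = 0`. -/
def IsCoupledZero (C : SignType × SignType → ℂ) : Prop :=
  ∀ X : U p, tensorRep p X *ᵥ C = counit p X • C

open scoped Matrix in
/-- The vectors with coefficients `C 1, C 0, C (-1)` in the tensor square transform as the standard
basis of the component `L = 1`. -/
def IsCoupledOne (C : SignType → SignType × SignType → ℂ) : Prop :=
  ∀ (X : U p) (M : SignType), tensorRep p X *ᵥ C M = ∑ M', rep p X M' M • C M'

/-- Clebsch-Gordan coefficients for `1 ⊗ 1 → 0`. -/
def cgZero : SignType × SignType → ℂ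
  | (.neg, .pos) => p
  | (.zero, .zero) => 1
  | (.pos, .neg) => -(p : ℂ)⁻¹
  | _ => 0

/-- Clebsch-Gordan coefficients for `1 ⊗ 1 → 1`; the first argument is the weight `M`. -/
def cgOne : SignType → SignType × SignType → ℂ
  | .pos, (.zero, .pos) => -(p : ℂ)
  | .pos, (.pos, .zero) => (p : ℂ)⁻¹
  | .zero, (.neg, .pos) => 1
  | .zero, (.zero, .zero) => (p : ℂ)⁻¹ + p
  | .zero, (.pos, .neg) => -1
  | .neg, (.neg, .zero) => p
  | .neg, (.zero, .neg) => -(p : ℂ)⁻¹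
  | _, _ => 0

/-- The composite `∑ C_{ij} z_i z_j` in an algebra. -/
def composite {B : Type*} [Ring B] [Algebra ℂ B] (C : SignType × SignType → ℂ)
    (z : SignType → B) : B :=
  ∑ k, C k • (z k.1 * z k.2)

end Coupling

/-! ### The coaction on noncommutative polynomials in the coordinates -/

section Coaction

variable (p : ℂˣ)

open GradedTensorProduct

instance : SuperAlgebra (FreeAlgebra ℂ SignType) where
  parity := freeParity par
  parity_parity := freeParity_freeParity par

/-- The right coaction `z_m ↦ ∑ z_{m'} ⊗ T_{m'm}` on the free superalgebra of the coordinates,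
extended multiplicatively. -/
def freeCoaction :
    FreeAlgebra ℂ SignType →ₐ[ℂ] part (FreeAlgebra ℂ SignType) ᵍ⊗[ℂ] part (A p) :=
  FreeAlgebra.lift ℂ fun m => ∑ m', FreeAlgebra.ι ℂ m' ᵍ⊗ₜ[ℂ] A.T p m' m

/-- The entries of `T^{(1)}(1)`: those of `T^{(1)}(0)` with the sign of the odd entries changed. -/
def A.T' (m' m : SignType) : A p := (-1 : ℂ) ^ (par m' + par m) • A.T p m' m

end Coaction

/-! ### The quantum superspace -/

section Plane

variable (p : ℂˣ) (r : ℂ)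

/-- `[n] = (q^{-n/2} - (-1)^n q^{n/2}) / (q^{-1/2} + q^{1/2})`. -/
def qint (n : ℕ) : ℂ := (((p : ℂ) ^ n)⁻¹ - (-1) ^ n * (p : ℂ) ^ n) / ((p : ℂ)⁻¹ + p)

/-- The defining relations of the quantum superspace, with `q = p²`. -/
def IsSuperspace {B : Type*} [Ring B] [Algebra ℂ B] (z : SignType → B) : Prop :=
  z 1 * z 0 = (p : ℂ) ^ 2 • (z 0 * z 1) ∧
  z 0 * z (-1) = (p : ℂ) ^ 2 • (z (-1) * z 0) ∧
  z 1 * z (-1) = ((p : ℂ) ^ 2) ^ 2 • (z (-1) * z 1) -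
    ((p : ℂ) ^ 2 * ((p : ℂ)⁻¹ + p) * r) • (1 : B) ∧
  z 0 ^ 2 = -(((p : ℂ) ^ 2)⁻¹ * qint p 2) • (z 1 * z (-1)) - (((p : ℂ) ^ 2)⁻¹ * r) • (1 : B)

open FreeAlgebra in
inductive PlaneRel : FreeAlgebra ℂ SignType → FreeAlgebra ℂ SignType → Prop
  | z1_z0 : PlaneRel (ι ℂ 1 * ι ℂ 0) ((p : ℂ) ^ 2 • (ι ℂ 0 * ι ℂ 1))
  | z0_zm : PlaneRel (ι ℂ 0 * ι ℂ (-1)) ((p : ℂ) ^ 2 • (ι ℂ (-1) * ι ℂ 0))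
  | z1_zm : PlaneRel (ι ℂ 1 * ι ℂ (-1)) (((p : ℂ) ^ 2) ^ 2 • (ι ℂ (-1) * ι ℂ 1) -
      ((p : ℂ) ^ 2 * ((p : ℂ)⁻¹ + p) * r) • 1)
  | z0_sq : PlaneRel (ι ℂ 0 ^ 2)
      (-(((p : ℂ) ^ 2)⁻¹ * qint p 2) • (ι ℂ 1 * ι ℂ (-1)) - (((p : ℂ) ^ 2)⁻¹ * r) • 1)

/-- The coordinate algebra of the quantum superspace. -/
abbrev Superspace : Type := RingQuot (PlaneRel p r)

/-- The coordinate `z_m`. -/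
def Superspace.z (m : SignType) : Superspace p r :=
  RingQuot.mkAlgHom ℂ (PlaneRel p r) (FreeAlgebra.ι ℂ m)

theorem par_one : par 1 = 0 := rfl
theorem par_zero : par 0 = 1 := rfl
theorem par_neg_one : par (-1) = 0 := rfl

instance : SuperAlgebra (Superspace p r) := quotientSuper par (PlaneRel p r) <| by
  intro a b h
  have h' := RingQuot.mkAlgHom_rel ℂ h
  cases h <;>
    simp only [map_mul, map_sub, map_neg, map_smul, map_pow, map_one, freeParity_ι, par_one, par_zero,
      par_neg_one, pow_zero, pow_one, one_smul, neg_smul, mul_neg, neg_mul, smul_neg, neg_sq, neg_inj]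
      at h' ⊢
  · rw [h']
  · rw [h']
  · exact h'
  · exact h'

end Plane

/-! ### Superalgebras generated by the coordinates over a superalgebra of parameters -/

section Parameters

variable (Λ : Type*) [Ring Λ] [Algebra ℂ Λ] [SuperAlgebra Λ]

/-- Even elements are central and odd elements anticommute. -/
def IsSupercommutative : Prop :=
  (∀ a b : Λ, parity a = a → a * b = b * a) ∧
    ∀ a b : Λ, parity a = -a → parity b = -b → a * b = -(b * a)

/-- The free left module on the words in the coordinates, which is the underlying module of the free
superalgebra over `Λ` on the even `z_1`, `z_{-1}` and the odd `z_0`. -/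
abbrev Words : Type _ := List SignType →₀ Λ

variable {Λ}

/-- The element `∑ C_{ij} z_i z_j`. -/
def compositeWords (C : SignType × SignType → ℂ) : Words Λ :=
  ∑ k, Finsupp.single [k.1, k.2] (algebraMap ℂ Λ (C k))

variable (Λ) in
/-- The `L = 0` relation `E^0_0 = r`, written as `E^0_0 - r`. -/
def relatorZero (p : ℂˣ) (r : ℂ) : Words Λ :=
  compositeWords (cgZero p) - Finsupp.single [] (algebraMap ℂ Λ r)

/-- The `L = 1` relation `E^1_M = ξ z_M`, written as `E^1_M - ξ z_M`. -/
def relatorOne (p : ℂˣ) (ξ : Λ) (M : SignType) : Words Λ :=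
  compositeWords (cgOne p M) - Finsupp.single [M] ξ

/-- The `L = 1` relations. -/
def relatorsOne (p : ℂˣ) (ξ : Λ) : Set (Words Λ) := Set.range (relatorOne p ξ)

/-- The `L = 0` and `L = 1` relations. -/
def relators (p : ℂˣ) (r : ℂ) (ξ : Λ) : Set (Words Λ) :=
  insert (relatorZero Λ p r) (relatorsOne p ξ)

/-- The value of a combination of words, the coefficients being sent to `R` by `j`. -/
def evalWords {R : Type*} [Ring R] (j : Λ → R) (z : SignType → R) (f : Words Λ) : R :=
  f.sum fun w c => j c * (w.map z).prod

/-- The relations of the superalgebra over `Λ` that is generated by the coordinates subject to the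
relators `S`: coefficients are added and multiplied as in `Λ`, and they supercommute with the
coordinates. -/
inductive SpaceRel (S : Set (Words Λ)) :
    FreeAlgebra ℂ (Λ ⊕ SignType) → FreeAlgebra ℂ (Λ ⊕ SignType) → Prop
  | add (a b : Λ) : SpaceRel S (FreeAlgebra.ι ℂ (.inl (a + b)))
      (FreeAlgebra.ι ℂ (.inl a) + FreeAlgebra.ι ℂ (.inl b))
  | mul (a b : Λ) : SpaceRel S (FreeAlgebra.ι ℂ (.inl (a * b)))
      (FreeAlgebra.ι ℂ (.inl a) * FreeAlgebra.ι ℂ (.inl b))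
  | scalar (c : ℂ) : SpaceRel S (FreeAlgebra.ι ℂ (.inl (algebraMap ℂ Λ c))) (algebraMap ℂ _ c)
  | comm (m : SignType) (a : Λ) : SpaceRel S
      (FreeAlgebra.ι ℂ (.inr m) * FreeAlgebra.ι ℂ (.inl a))
      (FreeAlgebra.ι ℂ (.inl ((parity : Λ → Λ)^[par m] a)) * FreeAlgebra.ι ℂ (.inr m))
  | relator (f : Words Λ) (hf : f ∈ S) : SpaceRel S
      (evalWords (fun a => FreeAlgebra.ι ℂ (.inl a)) (fun m => FreeAlgebra.ι ℂ (.inr m)) f) 0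

/-- The superalgebra over `Λ` generated by the coordinates subject to the relators `S`. -/
abbrev Space (S : Set (Words Λ)) : Type _ := RingQuot (SpaceRel S)

namespace Space

variable (S : Set (Words Λ))

/-- A coefficient, as an element of the algebra. -/
def coef (a : Λ) : Space S := RingQuot.mkAlgHom ℂ (SpaceRel S) (FreeAlgebra.ι ℂ (.inl a))

/-- The coordinate `z_m`. -/
def z (m : SignType) : Space S := RingQuot.mkAlgHom ℂ (SpaceRel S) (FreeAlgebra.ι ℂ (.inr m))

/-- The combination of the ordered monomials `z_{-1}^a z_0^ε z_1^b` with given coefficients. -/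
def orderedSum (c : ℕ × Fin 2 × ℕ →₀ Λ) : Space S :=
  c.sum fun k a => coef S a * (z S (-1) ^ k.1 * z S 0 ^ (k.2.1 : ℕ) * z S 1 ^ k.2.2)

/-- The ordered monomials are a basis over `Λ`. -/
def HasOrderedBasis : Prop := Function.Bijective (orderedSum S)

end Space

/-! ### Reordering of products, and the consistency conditions -/

/-- A word is ordered if it is of the form `z_{-1}^a z_0^ε z_1^b` with `ε = 0, 1`. -/
def IsOrdered (w : List SignType) : Prop := w.IsChain fun x y => x < y ∨ (x = y ∧ x ≠ 0)

/-- All words of `f` are ordered. -/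
def IsOrderedSum (f : Words Λ) : Prop := ∀ w ∈ f.support, IsOrdered w

/-- The product `u f v`, where the coefficients of `f` are moved to the left of `u`. -/
def insertWords (u v : List SignType) (f : Words Λ) : Words Λ :=
  f.sum fun w c => Finsupp.single (u ++ w ++ v) ((parity : Λ → Λ)^[(u.map par).sum] c)

/-- The reordering rule `z_x z_y = e` is a consequence of the relators: the pair is not in order, `e`
is, and `z_x z_y - e` is a combination of the relators with coefficients in `Λ`. -/
def IsRule (S : Set (Words Λ)) (x y : SignType) (e : Words Λ) : Prop :=
  ¬ IsOrdered [x, y] ∧ IsOrderedSum e ∧ Finsupp.single [x, y] 1 - e ∈ Submodule.span Λ S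

/-- One step of reordering: in one of the words, a neighbouring pair is replaced according to a
reordering rule. -/
def Step (S : Set (Words Λ)) (f g : Words Λ) : Prop :=
  ∃ (u v : List SignType) (x y : SignType) (e : Words Λ), IsRule S x y e ∧
    g = f.erase (u ++ x :: y :: v) + f (u ++ x :: y :: v) • insertWords u v e

/-- Any two ways of reordering a product of three coordinates give the same result. -/
def ReorderingConsistent (S : Set (Words Λ)) : Prop :=
  ∀ (x y t : SignType) (g₁ g₂ : Words Λ),
    Relation.ReflTransGen (Step S) (Finsupp.single [x, y, t] 1) g₁ → IsOrderedSum g₁ →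
    Relation.ReflTransGen (Step S) (Finsupp.single [x, y, t] 1) g₂ → IsOrderedSum g₂ → g₁ = g₂

/-- By the `L = 1` relations, the element `E^0_0`, which is to be set equal to the
constant `r`, commutes with all coordinates. -/
def RadiusCommutes (p : ℂˣ) (ξ : Λ) : Prop :=
  ∀ m : SignType, Commute (composite (cgZero p) (Space.z (relatorsOne p ξ)))
    (Space.z (relatorsOne p ξ) m)

/-- The relations for `L = 0` and `L = 1` are consistent: the constant `r` commutes with the
coordinates, and the result of reordering a product of three coordinates is unique. -/
def Consistent (p : ℂˣ) (r : ℂ) (ξ : Λ) : Prop :=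
  RadiusCommutes p ξ ∧ ReorderingConsistent (relators p r ξ)

end Parameters

end OSpq

end

/-!
The coupled vectors are pinned down by the generators alone: `K` fixes the weight of each vector, so
only few coordinates survive, and `v_±` fixes their ratios.

The pairing of a product of two matrix entries `T` with `X` is, up to sign, a matrix entry of the
action of `X` on `V ⊗ V`. Hence the intertwining property of the coupled vectors becomes a family of
quadratic identities in `𝒜`, and these identities say how the composites transform under the
coaction. The defining relations of the quantum superspace only involve composites, so it is
covariant.

For odd `ξ` the overlap `z_0 z_0 z_0` decides consistency. Rewriting its left pair or its right pair
first gives coefficients of `z_{-1} z_1` that differ by a multiple of `(q - 1) ξ`, since `ξ` changes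
sign when it is moved past `z_0`. For `ξ = 0` the superalgebra is `Λ ⊗ P`, and `P` acts on the span
of the ordered monomials by its left multiplication operators. Acting on the monomial `1` recovers
the coefficients, so the ordered monomials are a basis, and a basis forces all reorderings to agree.
-/

noncomputable section

namespace OSpq

open SuperAlgebra

section Coefficients

variable {M : Type*} [AddCommGroup M] [Module ℂ M] (p : ℂˣ)

theorem forall_signType {P : SignType → Prop} : (∀ m, P m) ↔ P 1 ∧ P 0 ∧ P (-1) :=
  ⟨fun h => ⟨h _, h _, h _⟩, fun ⟨h1, h2, h3⟩ m => by cases m <;> assumption⟩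

theorem sum_cgZero_smul (f : SignType × SignType → M) :
    ∑ k, cgZero p k • f k = (p : ℂ) • f (-1, 1) + f (0, 0) - (p : ℂ)⁻¹ • f (1, -1) := by
  simp only [Fintype.sum_prod_type, sum_sign, ← SignType.pos_eq_one, ← SignType.zero_eq_zero,
    cgZero]
  module

theorem sum_cgOne_one_smul (f : SignType × SignType → M) :
    ∑ k, cgOne p 1 k • f k = (p : ℂ)⁻¹ • f (1, 0) - (p : ℂ) • f (0, 1) := by
  simp only [Fintype.sum_prod_type, sum_sign, ← SignType.pos_eq_one, ← SignType.zero_eq_zero,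
    cgOne]
  module

theorem sum_cgOne_zero_smul (f : SignType × SignType → M) :
    ∑ k, cgOne p 0 k • f k = f (-1, 1) + ((p : ℂ)⁻¹ + p) • f (0, 0) - f (1, -1) := by
  simp only [Fintype.sum_prod_type, sum_sign, ← SignType.pos_eq_one, ← SignType.zero_eq_zero,
    cgOne]
  module

theorem sum_cgOne_neg_one_smul (f : SignType × SignType → M) :
    ∑ k, cgOne p (-1) k • f k = (p : ℂ) • f (-1, 0) - (p : ℂ)⁻¹ • f (0, -1) := by
  simp only [Fintype.sum_prod_type, sum_sign, ← SignType.pos_eq_one, ← SignType.zero_eq_zero,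
    cgOne]
  module

theorem pow_ne_one_of_dvd {p : ℂˣ} {k n : ℕ} (hp : p ^ n ≠ 1) (hk : k ∣ n) : (p : ℂ) ^ k ≠ 1 := by
  obtain ⟨d, rfl⟩ := hk
  intro h
  apply hp
  rw [pow_mul, show p ^ k = 1 from Units.ext (by simpa using h), one_pow]

theorem inv_add_self_ne_zero {p : ℂˣ} (hp : p ^ 4 ≠ 1) : (p : ℂ)⁻¹ + p ≠ 0 := by
  intro h
  have hsq : (p : ℂ) ^ 2 = -1 := by
    have := p.ne_zero
    field_simp at h
    linear_combination h
  apply pow_ne_one_of_dvd hp dvd_rfl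
  linear_combination ((p : ℂ) ^ 2 - 1) * hsq

theorem qint_two {p : ℂˣ} (hp : (p : ℂ)⁻¹ + p ≠ 0) : qint p 2 = (p : ℂ)⁻¹ - p := by
  rw [qint, div_eq_iff hp]
  ring

end Coefficients

section Relations

variable {B : Type*} [Ring B] [Algebra ℂ B]

/-- The relations of the quantum superspace solved for the products that are not of the form
`z_{-1}^a z_0^ε z_1^b`. In contrast to `IsSuperspace` no division is involved, so this form makes
sense for every `p`. -/
structure IsOrderedSuperspace (p : ℂˣ) (r : ℂ) (z : SignType → B) : Prop where
  one_mul_zero : z 1 * z 0 = (p : ℂ) ^ 2 • (z 0 * z 1)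
  zero_mul_neg_one : z 0 * z (-1) = (p : ℂ) ^ 2 • (z (-1) * z 0)
  one_mul_neg_one : z 1 * z (-1) =
    (p : ℂ) ^ 4 • (z (-1) * z 1) - (p * ((p : ℂ) ^ 2 + 1) * r) • (1 : B)
  zero_mul_zero : z 0 * z 0 = ((p : ℂ) ^ 3 - p) • (z (-1) * z 1) - ((p : ℂ) ^ 2 * r) • (1 : B)

theorem isOrderedSuperspace_iff (p : ℂˣ) (r : ℂ) (z : SignType → B) : IsOrderedSuperspace p r z ↔
    z 1 * z 0 = (p : ℂ) ^ 2 • (z 0 * z 1) ∧ z 0 * z (-1) = (p : ℂ) ^ 2 • (z (-1) * z 0) ∧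
      z 1 * z (-1) = (p : ℂ) ^ 4 • (z (-1) * z 1) - (p * ((p : ℂ) ^ 2 + 1) * r) • (1 : B) ∧
      z 0 * z 0 = ((p : ℂ) ^ 3 - p) • (z (-1) * z 1) - ((p : ℂ) ^ 2 * r) • (1 : B) :=
  ⟨fun ⟨h₁, h₂, h₃, h₄⟩ => ⟨h₁, h₂, h₃, h₄⟩, fun ⟨h₁, h₂, h₃, h₄⟩ => ⟨h₁, h₂, h₃, h₄⟩⟩

theorem isSuperspace_iff_isOrderedSuperspace {p : ℂˣ} (hp : (p : ℂ)⁻¹ + p ≠ 0) (r : ℂ)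
    (z : SignType → B) : IsSuperspace p r z ↔ IsOrderedSuperspace p r z := by
  have h0 : (p : ℂ) ≠ 0 := p.ne_zero
  rw [IsSuperspace, qint_two hp, sq (z 0), isOrderedSuperspace_iff]
  refine and_congr_right fun _ => and_congr_right fun _ => ?_
  rw [show (p : ℂ) ^ 2 * ((p : ℂ)⁻¹ + p) * r = p * ((p : ℂ) ^ 2 + 1) * r by field_simp; ring,
    ← pow_mul]
  refine and_congr_right fun h => ?_
  have solve : (-(((p : ℂ) ^ 2)⁻¹ * ((p : ℂ)⁻¹ - p))) • (z 1 * z (-1))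
      - (((p : ℂ) ^ 2)⁻¹ * r) • (1 : B) =
      ((p : ℂ) ^ 3 - p) • (z (-1) * z 1) - ((p : ℂ) ^ 2 * r) • (1 : B) := by
    rw [h]
    match_scalars <;> field_simp <;> ring
  rw [solve]

theorem composite_eq_iff_isOrderedSuperspace (p : ℂˣ) (r : ℂ) (z : SignType → B) :
    (composite (cgZero p) z = algebraMap ℂ B r ∧ ∀ M, composite (cgOne p M) z = 0) ↔
      IsOrderedSuperspace p r z := by
  have h0 : (p : ℂ) ≠ 0 := p.ne_zero
  rw [isOrderedSuperspace_iff, forall_signType]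
  simp only [composite, sum_cgZero_smul, sum_cgOne_one_smul, sum_cgOne_zero_smul,
    sum_cgOne_neg_one_smul, Algebra.algebraMap_eq_smul_one]
  constructor
  · rintro ⟨hr, h1, h0, hm⟩
    refine ⟨?_, ?_, ?_, ?_⟩
    · linear_combination (norm := (match_scalars <;> field_simp <;> ring)) (p : ℂ) • h1
    · linear_combination (norm := (match_scalars <;> field_simp <;> ring)) (-p : ℂ) • hm
    · linear_combination (norm := (match_scalars <;> field_simp <;> ring))
        (p : ℂ) ^ 2 • h0 - ((p : ℂ) * ((p : ℂ) ^ 2 + 1)) • hr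
    · linear_combination (norm := (match_scalars <;> field_simp <;> ring))
        (p : ℂ) • h0 - (p : ℂ) ^ 2 • hr
  · rintro ⟨h10, h0m, h1m, h00⟩
    refine ⟨?_, ?_, ?_, ?_⟩
    · linear_combination (norm := (match_scalars <;> field_simp <;> ring))
        h00 - (p : ℂ)⁻¹ • h1m
    · linear_combination (norm := (match_scalars <;> field_simp <;> ring)) (p : ℂ)⁻¹ • h10
    · linear_combination (norm := (match_scalars <;> field_simp <;> ring))
        ((p : ℂ)⁻¹ + p) • h00 - h1m
    · linear_combination (norm := (match_scalars <;> field_simp <;> ring)) (-(p : ℂ)⁻¹) • h0m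

theorem composite_eq_iff_isSuperspace {p : ℂˣ} (hp : (p : ℂ)⁻¹ + p ≠ 0) (r : ℂ)
    (z : SignType → B) :
    (composite (cgZero p) z = algebraMap ℂ B r ∧ ∀ M, composite (cgOne p M) z = 0) ↔
      IsSuperspace p r z := by
  rw [isSuperspace_iff_isOrderedSuperspace hp, composite_eq_iff_isOrderedSuperspace]

end Relations

section OrderedMonomials

/-- Left multiplication by `z_m` in terms of the ordered monomials, where `(a, ε, b)` stands for
`z_{-1}^a z_0^ε z_1^b`. The geometric sum comes from moving `z_1` past `z_{-1}^a`; it vanishes for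
`a = 0`, so that the truncated subtraction `a - 1` does no harm. -/
def leftOp (p : ℂˣ) (r : ℂ) (m : SignType) : Module.End ℂ (ℕ × Fin 2 × ℕ →₀ ℂ) :=
  Finsupp.linearCombination ℂ <| match m with
    | .neg => fun (a, e, b) => Finsupp.single (a + 1, e, b) 1
    | .zero => fun
      | (a, 0, b) => (p : ℂ) ^ (2 * a) • Finsupp.single (a, 1, b) 1
      | (a, 1, b) => (p : ℂ) ^ (2 * a) • (((p : ℂ) ^ 3 - p) • Finsupp.single (a + 1, 0, b + 1) 1 -
          ((p : ℂ) ^ 2 * r) • Finsupp.single (a, 0, b) 1)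
    | .pos => fun (a, e, b) =>
        (p : ℂ) ^ (4 * a + 2 * (e : ℕ)) • Finsupp.single (a, e, b + 1) 1 -
          (p * ((p : ℂ) ^ 2 + 1) * r * ∑ i ∈ Finset.range a, ((p : ℂ) ^ 4) ^ i) •
            Finsupp.single (a - 1, e, b) 1

variable {p : ℂˣ} {r : ℂ}

theorem leftOp_neg_one_single (a : ℕ) (e : Fin 2) (b : ℕ) :
    leftOp p r (-1) (Finsupp.single (a, e, b) 1) = Finsupp.single (a + 1, e, b) 1 :=
  (Finsupp.linearCombination_single ..).trans (one_smul ..)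

theorem leftOp_zero_single_zero (a b : ℕ) :
    leftOp p r 0 (Finsupp.single (a, 0, b) 1) = (p : ℂ) ^ (2 * a) • Finsupp.single (a, 1, b) 1 :=
  (Finsupp.linearCombination_single ..).trans (one_smul ..)

theorem leftOp_zero_single_one (a b : ℕ) :
    leftOp p r 0 (Finsupp.single (a, 1, b) 1) = (p : ℂ) ^ (2 * a) •
      (((p : ℂ) ^ 3 - p) • Finsupp.single (a + 1, 0, b + 1) 1 -
        ((p : ℂ) ^ 2 * r) • Finsupp.single (a, 0, b) 1) :=
  (Finsupp.linearCombination_single ..).trans (one_smul ..)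

theorem leftOp_one_single (a : ℕ) (e : Fin 2) (b : ℕ) :
    leftOp p r 1 (Finsupp.single (a, e, b) 1) =
      (p : ℂ) ^ (4 * a + 2 * (e : ℕ)) • Finsupp.single (a, e, b + 1) 1 -
        (p * ((p : ℂ) ^ 2 + 1) * r * ∑ i ∈ Finset.range a, ((p : ℂ) ^ 4) ^ i) •
          Finsupp.single (a - 1, e, b) 1 :=
  (Finsupp.linearCombination_single ..).trans (one_smul ..)

theorem end_ext_single {f g : Module.End ℂ (ℕ × Fin 2 × ℕ →₀ ℂ)}
    (h : ∀ a e b, f (Finsupp.single (a, e, b) 1) = g (Finsupp.single (a, e, b) 1)) : f = g :=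
  Finsupp.lhom_ext' fun ⟨a, e, b⟩ => LinearMap.ext_ring (h a e b)

theorem leftOp_one_mul_zero :
    leftOp p r 1 * leftOp p r 0 = (p : ℂ) ^ 2 • (leftOp p r 0 * leftOp p r 1) := by
  refine end_ext_single fun a e b => ?_
  rw [LinearMap.smul_apply, Module.End.mul_apply, Module.End.mul_apply]
  match e, a with
  | 0, 0 =>
    simp only [leftOp_one_single, leftOp_zero_single_zero, map_smul, map_sub, Finset.range_zero,
      Finset.sum_empty, Fin.val_zero, Fin.val_one]
    match_scalars <;> ring
  | 0, a + 1 =>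
    simp only [leftOp_one_single, leftOp_zero_single_zero, map_smul, map_sub, add_tsub_cancel_right,
      Fin.val_zero, Fin.val_one]
    match_scalars <;> ring
  | 1, 0 =>
    simp only [leftOp_one_single, leftOp_zero_single_one, map_smul, map_sub, Finset.range_zero,
      Finset.sum_empty, Finset.sum_range_succ, Fin.val_zero, Fin.val_one, zero_add,
      tsub_self]
    match_scalars <;> ring
  | 1, a + 1 =>
    simp only [leftOp_one_single, leftOp_zero_single_one, map_smul, map_sub, add_tsub_cancel_right,
      Finset.sum_range_succ _ (a + 1), Fin.val_zero, Fin.val_one]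
    match_scalars <;> ring

theorem leftOp_zero_mul_neg_one :
    leftOp p r 0 * leftOp p r (-1) = (p : ℂ) ^ 2 • (leftOp p r (-1) * leftOp p r 0) := by
  refine end_ext_single fun a e b => ?_
  rw [LinearMap.smul_apply, Module.End.mul_apply, Module.End.mul_apply]
  match e with
  | 0 =>
    simp only [leftOp_neg_one_single, leftOp_zero_single_zero, map_smul]
    match_scalars
    ring
  | 1 =>
    simp only [leftOp_neg_one_single, leftOp_zero_single_one, map_smul, map_sub]
    match_scalars <;> ring

theorem leftOp_one_mul_neg_one :
    leftOp p r 1 * leftOp p r (-1) = (p : ℂ) ^ 4 • (leftOp p r (-1) * leftOp p r 1) -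
      (p * ((p : ℂ) ^ 2 + 1) * r) • (1 : Module.End ℂ (ℕ × Fin 2 × ℕ →₀ ℂ)) := by
  refine end_ext_single fun a e b => ?_
  simp only [LinearMap.sub_apply, LinearMap.smul_apply, Module.End.mul_apply,
    Module.End.one_apply, leftOp_neg_one_single, leftOp_one_single, map_smul, map_sub]
  cases a with
  | zero =>
    simp only [Finset.range_zero, Finset.sum_empty, Finset.sum_range_succ, zero_add, tsub_self]
    match_scalars <;> ring
  | succ a =>
    simp only [add_tsub_cancel_right, geom_sum_succ (n := a + 1)]
    match_scalars <;> ring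

theorem leftOp_zero_mul_zero :
    leftOp p r 0 * leftOp p r 0 = ((p : ℂ) ^ 3 - p) • (leftOp p r (-1) * leftOp p r 1) -
      ((p : ℂ) ^ 2 * r) • (1 : Module.End ℂ (ℕ × Fin 2 × ℕ →₀ ℂ)) := by
  refine end_ext_single fun a e b => ?_
  have geom := mul_geom_sum ((p : ℂ) ^ 4) a
  have square : leftOp p r 0 (leftOp p r 0 (Finsupp.single (a, e, b) 1)) = (p : ℂ) ^ (4 * a) •
      (((p : ℂ) ^ (2 * (e : ℕ)) * ((p : ℂ) ^ 3 - p)) • Finsupp.single (a + 1, e, b + 1) 1 -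
        ((p : ℂ) ^ 2 * r) • Finsupp.single (a, e, b) 1) := by
    match e with
    | 0 =>
      simp only [leftOp_zero_single_zero, leftOp_zero_single_one, map_smul, Fin.val_zero]
      match_scalars <;> ring
    | 1 =>
      simp only [leftOp_zero_single_zero, leftOp_zero_single_one, map_smul, map_sub, Fin.val_one]
      match_scalars <;> ring
  simp only [LinearMap.sub_apply, LinearMap.smul_apply, Module.End.mul_apply,
    Module.End.one_apply, square, leftOp_neg_one_single, leftOp_one_single, map_smul, map_sub]
  cases a with
  | zero =>
    simp only [Finset.range_zero, Finset.sum_empty]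
    match_scalars <;> ring
  | succ a =>
    simp only [add_tsub_cancel_right]
    match_scalars
    · ring
    · linear_combination p ^ 2 * r * geom

theorem isOrderedSuperspace_leftOp (p : ℂˣ) (r : ℂ) : IsOrderedSuperspace p r (leftOp p r) :=
  ⟨leftOp_one_mul_zero, leftOp_zero_mul_neg_one, leftOp_one_mul_neg_one, leftOp_zero_mul_zero⟩

section Monomial

variable {B : Type*} [Ring B] [Algebra ℂ B] {z : SignType → B}

/-- The ordered monomial `z_{-1}^a z_0^ε z_1^b` with exponents `k = (a, ε, b)`. -/
def monomial (z : SignType → B) (k : ℕ × Fin 2 × ℕ) : B :=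
  z (-1) ^ k.1 * z 0 ^ (k.2.1 : ℕ) * z 1 ^ k.2.2

theorem zero_mul_neg_one_pow (h : z 0 * z (-1) = (p : ℂ) ^ 2 • (z (-1) * z 0)) (a : ℕ) :
    z 0 * z (-1) ^ a = (p : ℂ) ^ (2 * a) • (z (-1) ^ a * z 0) := by
  induction a with
  | zero => simp
  | succ a ih =>
    rw [pow_succ, ← mul_assoc, ih, smul_mul_assoc, mul_assoc, h, mul_smul_comm, smul_smul,
      ← mul_assoc]
    congr 1
    ring

theorem one_mul_neg_one_pow {c : ℂ}
    (h : z 1 * z (-1) = (p : ℂ) ^ 4 • (z (-1) * z 1) - c • (1 : B)) (a : ℕ) :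
    z 1 * z (-1) ^ a = (p : ℂ) ^ (4 * a) • (z (-1) ^ a * z 1) -
      (c * ∑ i ∈ Finset.range a, ((p : ℂ) ^ 4) ^ i) • z (-1) ^ (a - 1) := by
  induction a with
  | zero => simp
  | succ a ih =>
    have absorb : (∑ i ∈ Finset.range a, ((p : ℂ) ^ 4) ^ i) • (z (-1) ^ (a - 1) * z (-1)) =
        (∑ i ∈ Finset.range a, ((p : ℂ) ^ 4) ^ i) • z (-1) ^ a := by
      cases a with
      | zero => simp
      | succ a => rw [add_tsub_cancel_right, pow_succ (z (-1))]
    rw [pow_succ (z (-1)), ← mul_assoc, ih, sub_mul, smul_mul_assoc, mul_assoc, h, smul_mul_assoc,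
      mul_smul c, absorb, Finset.sum_range_succ, mul_sub, mul_smul_comm, mul_smul_comm, mul_one,
      ← mul_assoc, add_tsub_cancel_right]
    match_scalars <;> ring

theorem neg_one_mul_monomial (z : SignType → B) (k : ℕ × Fin 2 × ℕ) : z (-1) * monomial z k =
    Finsupp.linearCombination ℂ (monomial z) (leftOp p r (-1) (Finsupp.single k 1)) := by
  rw [leftOp_neg_one_single, Finsupp.linearCombination_single, one_smul]
  simp only [monomial, pow_succ', mul_assoc]

theorem zero_mul_monomial (hz : IsOrderedSuperspace p r z) (k : ℕ × Fin 2 × ℕ) :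
    z 0 * monomial z k =
      Finsupp.linearCombination ℂ (monomial z) (leftOp p r 0 (Finsupp.single k 1)) := by
  match k with
  | (a, 0, b) =>
    simp only [leftOp_zero_single_zero, map_smul, Finsupp.linearCombination_single, one_smul,
      monomial, ← mul_assoc, zero_mul_neg_one_pow hz.zero_mul_neg_one, Fin.val_zero, Fin.val_one,
      pow_zero, pow_one, mul_one, smul_mul_assoc]
  | (a, 1, b) =>
    simp only [leftOp_zero_single_one, map_smul, map_sub, Finsupp.linearCombination_single,
      one_smul, monomial, ← mul_assoc, zero_mul_neg_one_pow hz.zero_mul_neg_one, Fin.val_zero,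
      Fin.val_one, pow_zero, pow_one, mul_one, smul_mul_assoc]
    rw [mul_assoc _ (z 0) (z 0), hz.zero_mul_zero, pow_succ (z (-1)), pow_succ' (z 1)]
    simp only [mul_sub, sub_mul, mul_smul_comm, smul_mul_assoc, mul_one, mul_assoc]

theorem one_mul_monomial (hz : IsOrderedSuperspace p r z) (k : ℕ × Fin 2 × ℕ) :
    z 1 * monomial z k =
      Finsupp.linearCombination ℂ (monomial z) (leftOp p r 1 (Finsupp.single k 1)) := by
  obtain ⟨a, e, b⟩ := k
  have pass : z 1 * z 0 ^ (e : ℕ) = (p : ℂ) ^ (2 * (e : ℕ)) • (z 0 ^ (e : ℕ) * z 1) := by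
    match e with
    | 0 => simp
    | 1 => simpa using hz.one_mul_zero
  simp only [leftOp_one_single, map_sub, map_smul, Finsupp.linearCombination_single, one_smul,
    monomial]
  rw [← mul_assoc, ← mul_assoc, one_mul_neg_one_pow hz.one_mul_neg_one, sub_mul, sub_mul,
    smul_mul_assoc, mul_assoc (z (-1) ^ a), pass, pow_succ' (z 1)]
  simp only [mul_smul_comm, smul_mul_assoc, mul_assoc, smul_smul, pow_add]

theorem mul_monomial (hz : IsOrderedSuperspace p r z) (m : SignType) (k : ℕ × Fin 2 × ℕ) :
    z m * monomial z k =
      Finsupp.linearCombination ℂ (monomial z) (leftOp p r m (Finsupp.single k 1)) := by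
  cases m with
  | pos => exact one_mul_monomial hz k
  | zero => exact zero_mul_monomial hz k
  | neg => exact neg_one_mul_monomial z k

theorem monomial_leftOp_single_zero (p : ℂˣ) (r : ℂ) (k : ℕ × Fin 2 × ℕ) :
    monomial (leftOp p r) k (Finsupp.single (0, 0, 0) 1) = Finsupp.single k 1 := by
  have one_pow (b : ℕ) : (leftOp p r 1 ^ b) (Finsupp.single (0, 0, 0) 1) =
      Finsupp.single (0, 0, b) 1 := by
    induction b with
    | zero => rfl
    | succ b ih =>
      rw [pow_succ', Module.End.mul_apply, ih, leftOp_one_single]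
      simp
  have zero_pow (e : Fin 2) (b : ℕ) : (leftOp p r 0 ^ (e : ℕ)) (Finsupp.single (0, 0, b) 1) =
      Finsupp.single (0, e, b) 1 := by
    match e with
    | 0 => rfl
    | 1 =>
      rw [Fin.val_one, pow_one, leftOp_zero_single_zero, mul_zero, pow_zero, one_smul]
  have neg_one_pow (a : ℕ) (e : Fin 2) (b : ℕ) :
      (leftOp p r (-1) ^ a) (Finsupp.single (0, e, b) 1) = Finsupp.single (a, e, b) 1 := by
    induction a with
    | zero => rfl
    | succ a ih => rw [pow_succ', Module.End.mul_apply, ih, leftOp_neg_one_single]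
  rw [monomial, Module.End.mul_apply, Module.End.mul_apply, one_pow, zero_pow, neg_one_pow]

end Monomial

end OrderedMonomials

section Homogeneous

open GradedTensorProduct

variable {A B : Type*} [Ring A] [Algebra ℂ A] [SuperAlgebra A] [Ring B] [Algebra ℂ B]
  [SuperAlgebra B]

theorem parity_induction {P : A → Prop}
    (hom : ∀ (n : ℕ) (a : A), parity a = (-1 : ℂ) ^ n • a → P a)
    (add : ∀ a b, P a → P b → P (a + b)) (a : A) : P a := by
  have h : a = (1 / 2 : ℂ) • (a + parity a) + (1 / 2 : ℂ) • (a - parity a) := by module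
  rw [h]
  refine add _ _ (hom 0 _ ?_) (hom 1 _ ?_) <;> simp only [map_smul, map_add, map_sub, parity_parity]
  · module
  · module

theorem iterate_parity_of_parity {a : A} {m : ℕ} (ha : parity a = (-1 : ℂ) ^ m • a) (n : ℕ) :
    (parity : A → A)^[n] a = (-1 : ℂ) ^ (n * m) • a := by
  induction n with
  | zero => rw [zero_mul, pow_zero, one_smul, Function.iterate_zero_apply]
  | succ n ih =>
    rw [Function.iterate_succ_apply', ih, map_smul, ha, smul_smul, ← pow_add, Nat.succ_mul]

theorem tmul_mul_tmul_of_parity (a : A) {a' : A} {b : B} (b' : B) {m n : ℕ}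
    (hb : parity b = (-1 : ℂ) ^ m • b) (ha : parity a' = (-1 : ℂ) ^ n • a') :
    (a ᵍ⊗ₜ[ℂ] b * a' ᵍ⊗ₜ[ℂ] b' : part A ᵍ⊗[ℂ] part B) =
      (-1 : ℂ) ^ (m * n) • (a * a') ᵍ⊗ₜ[ℂ] (b * b') := by
  rcases Nat.even_or_odd m with hm | hm
  · rw [hm.neg_one_pow, one_smul] at hb
    rw [tmul_mul_tmul_even_left _ _ _ _ hb, (hm.mul_right n).neg_one_pow, one_smul]
  · rcases Nat.even_or_odd n with hn | hn
    · rw [hn.neg_one_pow, one_smul] at ha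
      rw [tmul_mul_tmul_even_right _ _ _ _ ha, (hn.mul_left m).neg_one_pow, one_smul]
    · rw [hm.neg_one_pow, neg_one_smul] at hb
      rw [hn.neg_one_pow, neg_one_smul] at ha
      rw [tmul_mul_tmul_odd _ _ _ _ ha hb, (hm.mul hn).neg_one_pow, neg_one_smul]

theorem tmul_mul_tmul_of_parity_left (a a' : A) {b : B} (b' : B) {n : ℕ}
    (hb : parity b = (-1 : ℂ) ^ n • b) :
    (a ᵍ⊗ₜ[ℂ] b * a' ᵍ⊗ₜ[ℂ] b' : part A ᵍ⊗[ℂ] part B) =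
      (a * (parity : A → A)^[n] a') ᵍ⊗ₜ[ℂ] (b * b') := by
  induction a' using parity_induction with
  | hom m a' ha =>
    rw [tmul_mul_tmul_of_parity a b' hb ha, iterate_parity_of_parity ha, mul_smul_comm]
    simp only [tmul, ← TensorProduct.smul_tmul', map_smul]
  | add x y hx hy =>
    rw [iterate_map_add]
    simp only [tmul, TensorProduct.add_tmul, map_add, mul_add] at hx hy ⊢
    rw [hx, hy]

theorem graded_induction {P : part A ᵍ⊗[ℂ] part B → Prop} (zero : P 0)
    (tmul : ∀ a b, P (a ᵍ⊗ₜ[ℂ] b)) (add : ∀ x y, P x → P y → P (x + y))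
    (Z : part A ᵍ⊗[ℂ] part B) : P Z := by
  obtain ⟨Z, rfl⟩ := (GradedTensorProduct.of ℂ (part A) (part B)).surjective Z
  induction Z using TensorProduct.induction_on with
  | zero => rw [map_zero]; exact zero
  | tmul a b => exact tmul a b
  | add x y hx hy => rw [map_add]; exact add _ _ hx hy

end Homogeneous

namespace Superspace

variable {p : ℂˣ} {r : ℂ}

theorem isSuperspace_z (p : ℂˣ) (r : ℂ) : IsSuperspace p r (z p r) := by
  refine ⟨?_, ?_, ?_, ?_⟩
  · simpa [z] using RingQuot.mkAlgHom_rel ℂ (PlaneRel.z1_z0 (p := p) (r := r))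
  · simpa [z] using RingQuot.mkAlgHom_rel ℂ (PlaneRel.z0_zm (p := p) (r := r))
  · simpa [z] using RingQuot.mkAlgHom_rel ℂ (PlaneRel.z1_zm (p := p) (r := r))
  · have h := RingQuot.mkAlgHom_rel ℂ (PlaneRel.z0_sq (p := p) (r := r))
    simp only [map_sub, map_smul, map_mul, map_pow, map_one] at h
    exact h

theorem parity_z (m : SignType) : parity (z p r m) = (-1 : ℂ) ^ par m • z p r m := by
  rw [z]
  refine (quotientParity_mk par (PlaneRel p r) _ _).trans ?_
  rw [freeParity_ι, map_smul]

/-- The homomorphism out of the quantum superspace that is given by elements satisfying its defining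
relations. -/
def lift {B : Type*} [Ring B] [Algebra ℂ B] (ζ : SignType → B) (hζ : IsSuperspace p r ζ) :
    Superspace p r →ₐ[ℂ] B :=
  RingQuot.liftAlgHom ℂ ⟨FreeAlgebra.lift ℂ ζ, by
    obtain ⟨h1, h2, h3, h4⟩ := hζ
    intro a b h
    cases h
    · simpa using h1
    · simpa using h2
    · simpa using h3
    · simpa using h4⟩

theorem lift_z {B : Type*} [Ring B] [Algebra ℂ B] (ζ : SignType → B) (hζ : IsSuperspace p r ζ)
    (m : SignType) : lift ζ hζ (z p r m) = ζ m := by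
  simp [lift, z]

end Superspace

section Evaluation

variable {Λ : Type*} [Ring Λ] {R : Type*} [Ring R]

/-- The word of the ordered monomial `z_{-1}^a z_0^ε z_1^b`. -/
def orderedWord (k : ℕ × Fin 2 × ℕ) : List SignType :=
  List.replicate k.1 (-1) ++ List.replicate k.2.1 0 ++ List.replicate k.2.2 1

theorem prod_map_orderedWord (z : SignType → R) (k : ℕ × Fin 2 × ℕ) :
    ((orderedWord k).map z).prod = monomial z k := by
  simp [orderedWord, monomial, mul_assoc]

theorem exists_orderedWord {w : List SignType} (hw : IsOrdered w) : ∃ k, orderedWord k = w := by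
  induction w with
  | nil => exact ⟨(0, 0, 0), rfl⟩
  | cons x w ih =>
    rw [IsOrdered, List.isChain_cons] at hw
    obtain ⟨hx, hw⟩ := hw
    obtain ⟨⟨a, e, b⟩, rfl⟩ := ih hw
    revert x
    rw [forall_signType]
    refine ⟨fun hx => ?_, fun hx => ?_, fun _ => ⟨(a + 1, e, b), rfl⟩⟩
    all_goals
      obtain rfl : a = 0 := by
        by_contra ha
        obtain ⟨a, rfl⟩ := Nat.exists_eq_succ_of_ne_zero ha
        exact absurd (hx (-1) (by simp [orderedWord, List.replicate_succ])) (by decide)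
      obtain rfl : e = 0 := by
        by_contra he
        obtain rfl : e = 1 := Fin.eq_one_of_ne_zero e he
        exact absurd (hx 0 (by simp [orderedWord])) (by decide)
    · exact ⟨(0, 0, b + 1), rfl⟩
    · exact ⟨(0, 1, b), rfl⟩

theorem exists_mapDomain_orderedWord {f : Words Λ} (hf : IsOrderedSum f) :
    ∃ c : ℕ × Fin 2 × ℕ →₀ Λ, c.mapDomain orderedWord = f := by
  choose k hk using fun w : f.support => exists_orderedWord (hf w w.2)
  refine ⟨∑ w : f.support, Finsupp.single (k w) (f w), ?_⟩
  rw [Finsupp.mapDomain_finsetSum]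
  simp only [Finsupp.mapDomain_single, hk]
  rw [Finset.sum_coe_sort f.support fun w => Finsupp.single w (f w)]
  exact f.sum_single

variable [Algebra ℂ Λ] [Algebra ℂ R]

/-- `evalWords` as an additive map. -/
def evalHom (j : Λ →ₐ[ℂ] R) (z : SignType → R) : Words Λ →+ R :=
  Finsupp.liftAddHom fun w => (AddMonoidHom.mulRight (w.map z).prod).comp (j : Λ →+ R)

variable (j : Λ →ₐ[ℂ] R) (z : SignType → R)

theorem evalHom_apply (f : Words Λ) : evalHom j z f = evalWords j z f := rfl

theorem evalHom_single (w : List SignType) (c : Λ) :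
    evalHom j z (Finsupp.single w c) = j c * (w.map z).prod := by
  simp [evalHom]

theorem evalHom_smul (a : Λ) (f : Words Λ) : evalHom j z (a • f) = j a * evalHom j z f := by
  induction f using Finsupp.induction_linear with
  | zero => simp
  | add f g hf hg => rw [smul_add, map_add, hf, hg, map_add, mul_add]
  | single w c => rw [Finsupp.smul_single, evalHom_single, evalHom_single, smul_eq_mul, map_mul,
      mul_assoc]

theorem evalHom_compositeWords (C : SignType × SignType → ℂ) :
    evalHom j z (compositeWords C) = composite C z := by
  simp [compositeWords, composite, map_sum, evalHom_single, Algebra.smul_def]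

theorem evalHom_relatorZero (p : ℂˣ) (r : ℂ) :
    evalHom j z (relatorZero Λ p r) = composite (cgZero p) z - algebraMap ℂ R r := by
  simp [relatorZero, evalHom_compositeWords, evalHom_single]

theorem evalHom_relatorOne (p : ℂˣ) (ξ : Λ) (M : SignType) :
    evalHom j z (relatorOne p ξ M) = composite (cgOne p M) z - j ξ * z M := by
  simp [relatorOne, evalHom_compositeWords, evalHom_single]

theorem forall_relators {p : ℂˣ} {r : ℂ} {ξ : Λ} {P : Words Λ → Prop} :
    (∀ f ∈ relators p r ξ, P f) ↔ P (relatorZero Λ p r) ∧ ∀ M, P (relatorOne p ξ M) := by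
  simp [relators, relatorsOne]

theorem evalHom_relators_zero_iff (p : ℂˣ) (r : ℂ) :
    (∀ f ∈ relators p r (0 : Λ), evalHom j z f = 0) ↔ IsOrderedSuperspace p r z := by
  simp only [forall_relators, evalHom_relatorZero, evalHom_relatorOne, map_zero, zero_mul, sub_zero,
    sub_eq_zero, composite_eq_iff_isOrderedSuperspace]

variable [SuperAlgebra Λ]

theorem insertWords_single (u v w : List SignType) (c : Λ) :
    insertWords u v (Finsupp.single w c) =
      Finsupp.single (u ++ w ++ v) ((parity : Λ → Λ)^[(u.map par).sum] c) := by
  rw [insertWords, Finsupp.sum_single_index]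
  rw [iterate_map_zero, Finsupp.single_zero]

theorem insertWords_add (u v : List SignType) (f g : Words Λ) :
    insertWords u v (f + g) = insertWords u v f + insertWords u v g := by
  rw [insertWords, Finsupp.sum_add_index']
  · rfl
  · intro w; rw [iterate_map_zero, Finsupp.single_zero]
  · intro w a b; rw [iterate_map_add, Finsupp.single_add]

theorem insertWords_zero (u v : List SignType) : insertWords u v (0 : Words Λ) = 0 := by
  rw [insertWords, Finsupp.sum_zero_index]

/-- The images `j a` of the coefficients and `z m` of the coordinates in an algebra satisfy the
relations of the superalgebra over `Λ` with relators `S`. -/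
structure IsRealization (S : Set (Words Λ)) (j : Λ →ₐ[ℂ] R) (z : SignType → R) : Prop where
  mul_coef : ∀ m a, z m * j a = j ((parity : Λ → Λ)^[par m] a) * z m
  evalHom_eq_zero : ∀ f ∈ S, evalHom j z f = 0

namespace IsRealization

variable {S : Set (Words Λ)} {j : Λ →ₐ[ℂ] R} {z : SignType → R} (h : IsRealization S j z)

include h

theorem prod_mul_coef (u : List SignType) (a : Λ) :
    (u.map z).prod * j a = j ((parity : Λ → Λ)^[(u.map par).sum] a) * (u.map z).prod := by
  induction u generalizing a with
  | nil => simp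
  | cons m u ih =>
    rw [List.map_cons, List.prod_cons, mul_assoc, ih, ← mul_assoc, h.mul_coef,
      ← Function.iterate_add_apply, List.map_cons, List.sum_cons, mul_assoc]

theorem evalHom_insertWords (u v : List SignType) (f : Words Λ) :
    evalHom j z (insertWords u v f) = (u.map z).prod * evalHom j z f * (v.map z).prod := by
  induction f using Finsupp.induction_linear with
  | zero => simp [insertWords_zero]
  | add f g hf hg => rw [insertWords_add, map_add, hf, hg, map_add, mul_add, add_mul]
  | single w c =>
    rw [insertWords_single, evalHom_single, evalHom_single, ← mul_assoc, h.prod_mul_coef]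
    simp [mul_assoc]

theorem evalHom_eq_zero_of_mem_span {f : Words Λ} (hf : f ∈ Submodule.span Λ S) :
    evalHom j z f = 0 := by
  induction hf using Submodule.span_induction with
  | mem f hf => exact h.evalHom_eq_zero f hf
  | zero => exact map_zero _
  | add f g _ _ hf hg => rw [map_add, hf, hg, add_zero]
  | smul a f _ hf => rw [evalHom_smul, hf, mul_zero]

theorem evalHom_step {f g : Words Λ} (hfg : Step S f g) : evalHom j z g = evalHom j z f := by
  obtain ⟨u, v, x, y, e, ⟨-, -, he⟩, rfl⟩ := hfg
  have he : z x * z y = evalHom j z e := by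
    simpa [evalHom_single, sub_eq_zero] using h.evalHom_eq_zero_of_mem_span he
  conv_rhs => rw [← Finsupp.erase_add_single (u ++ x :: y :: v) f]
  rw [map_add, map_add, evalHom_smul, h.evalHom_insertWords, ← he, evalHom_single]
  simp [mul_assoc]

theorem evalHom_reflTransGen_step {f g : Words Λ} (hfg : Relation.ReflTransGen (Step S) f g) :
    evalHom j z g = evalHom j z f := by
  induction hfg with
  | refl => rfl
  | tail _ hstep ih => rw [h.evalHom_step hstep, ih]

end IsRealization

end Evaluation

theorem IsOrderedSuperspace.map {B B' : Type*} [Ring B] [Algebra ℂ B] [Ring B'] [Algebra ℂ B']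
    {p : ℂˣ} {r : ℂ} {z : SignType → B} (hz : IsOrderedSuperspace p r z) (f : B →ₐ[ℂ] B') :
    IsOrderedSuperspace p r (f ∘ z) where
  one_mul_zero := by simpa using congrArg f hz.one_mul_zero
  zero_mul_neg_one := by simpa using congrArg f hz.zero_mul_neg_one
  one_mul_neg_one := by simpa using congrArg f hz.one_mul_neg_one
  zero_mul_zero := by simpa using congrArg f hz.zero_mul_zero

theorem map_monomial {B B' : Type*} [Ring B] [Ring B'] (f : B →+* B') (z : SignType → B)
    (k : ℕ × Fin 2 × ℕ) : f (monomial z k) = monomial (f ∘ z) k := by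
  simp only [monomial, map_mul, map_pow, Function.comp_apply]

namespace Superspace

variable {p : ℂˣ} {r : ℂ}

theorem isOrderedSuperspace_z (hp : (p : ℂ)⁻¹ + p ≠ 0) (r : ℂ) :
    IsOrderedSuperspace p r (z p r) :=
  (isSuperspace_iff_isOrderedSuperspace hp r _).1 (isSuperspace_z p r)

/-- The coefficients of an element of the quantum superspace with respect to the ordered monomials,
found by letting it act on the ordered monomial `1`. -/
def coords (hp : (p : ℂ)⁻¹ + p ≠ 0) (r : ℂ) : Superspace p r →ₗ[ℂ] (ℕ × Fin 2 × ℕ →₀ ℂ) :=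
  LinearMap.applyₗ (Finsupp.single (0, 0, 0) 1) ∘ₗ (lift (leftOp p r) <|
    (isSuperspace_iff_isOrderedSuperspace hp r _).2 (isOrderedSuperspace_leftOp p r)).toLinearMap

theorem coords_monomial (hp : (p : ℂ)⁻¹ + p ≠ 0) (r : ℂ) (k : ℕ × Fin 2 × ℕ) :
    coords hp r (monomial (z p r) k) = Finsupp.single k 1 := by
  rw [← monomial_leftOp_single_zero p r k]
  refine congrArg (fun f : Module.End ℂ _ => f (Finsupp.single (0, 0, 0) 1)) ?_
  refine (map_monomial (AlgHom.toRingHom _) _ _).trans (congrArg (monomial · k) ?_)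
  exact funext fun m => lift_z _ _ m

end Superspace

namespace Space

variable {Λ : Type*} [Ring Λ] [Algebra ℂ Λ] [SuperAlgebra Λ] (S : Set (Words Λ))

/-- The coefficients, as a homomorphism to the superalgebra with relators `S`. -/
def coefHom : Λ →ₐ[ℂ] Space S :=
  have hc : ∀ c : ℂ, coef S (algebraMap ℂ Λ c) = algebraMap ℂ _ c := fun c => by
    simpa [coef] using RingQuot.mkAlgHom_rel ℂ (SpaceRel.scalar (S := S) c)
  { toFun := coef S
    map_one' := by simpa using hc 1
    map_zero' := by simpa using hc 0
    map_mul' := fun a b => by simpa [coef] using RingQuot.mkAlgHom_rel ℂ (SpaceRel.mul (S := S) a b)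
    map_add' := fun a b => by simpa [coef] using RingQuot.mkAlgHom_rel ℂ (SpaceRel.add (S := S) a b)
    commutes' := hc }

theorem coefHom_apply (a : Λ) : coefHom S a = coef S a := rfl

theorem isRealization : IsRealization S (coefHom S) (z S) where
  mul_coef m a := by
    simpa [coef, z, coefHom_apply] using RingQuot.mkAlgHom_rel ℂ (SpaceRel.comm (S := S) m a)
  evalHom_eq_zero f hf := by
    have h := RingQuot.mkAlgHom_rel ℂ (SpaceRel.relator (S := S) f hf)
    rw [map_zero, evalWords, map_finsuppSum] at h
    rw [evalHom_apply, evalWords, ← h]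
    refine Finsupp.sum_congr fun w _ => ?_
    rw [map_mul, map_list_prod, List.map_map]
    rfl

@[elab_as_elim]
theorem induction {P : Space S → Prop} (coef : ∀ a, P (coefHom S a)) (z : ∀ m, P (z S m))
    (add : ∀ x y, P x → P y → P (x + y)) (mul : ∀ x y, P x → P y → P (x * y)) (x : Space S) :
    P x := by
  obtain ⟨f, rfl⟩ := RingQuot.mkAlgHom_surjective ℂ (SpaceRel S) x
  induction f using FreeAlgebra.induction with
  | grade0 c => rw [AlgHom.commutes, ← (coefHom S).commutes]; exact coef _
  | grade1 g =>
    cases g with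
    | inl a => exact coef a
    | inr m => exact z m
  | mul x y hx hy => rw [map_mul]; exact mul _ _ hx hy
  | add x y hx hy => rw [map_add]; exact add _ _ hx hy

section Lift

variable {S} {R : Type*} [Ring R] [Algebra ℂ R] {j : Λ →ₐ[ℂ] R} {ζ : SignType → R}

/-- The homomorphism out of the superalgebra with relators `S` that is given by images of the
coefficients and of the coordinates satisfying its relations. -/
def lift (h : IsRealization S j ζ) : Space S →ₐ[ℂ] R :=
  RingQuot.liftAlgHom ℂ ⟨FreeAlgebra.lift ℂ (Sum.elim j ζ), by
    intro a b hab
    cases hab with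
    | add a b => simp
    | mul a b => simp
    | scalar c => simp
    | comm m a => simpa using h.mul_coef m a
    | relator f hf =>
      rw [map_zero, evalWords, map_finsuppSum, ← h.evalHom_eq_zero f hf, evalHom_apply, evalWords]
      refine Finsupp.sum_congr fun w _ => ?_
      rw [map_mul, map_list_prod, List.map_map]
      simp [Function.comp_def]⟩

theorem lift_coefHom (h : IsRealization S j ζ) (a : Λ) : lift h (coefHom S a) = j a := by
  simp [lift, coefHom_apply, coef]

theorem lift_z (h : IsRealization S j ζ) (m : SignType) : lift h (z S m) = ζ m := by
  simp [lift, z]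

end Lift

/-- `orderedSum` as an additive map. -/
def orderedHom : (ℕ × Fin 2 × ℕ →₀ Λ) →+ Space S :=
  Finsupp.liftAddHom fun k => (AddMonoidHom.mulRight (monomial (z S) k)).comp
    (coefHom S : Λ →+ Space S)

theorem orderedHom_apply (c : ℕ × Fin 2 × ℕ →₀ Λ) : orderedHom S c = orderedSum S c := rfl

theorem orderedHom_single (k : ℕ × Fin 2 × ℕ) (a : Λ) :
    orderedHom S (Finsupp.single k a) = coefHom S a * monomial (z S) k := by
  simp [orderedHom]

theorem evalHom_mapDomain_orderedWord (c : ℕ × Fin 2 × ℕ →₀ Λ) :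
    evalHom (coefHom S) (z S) (c.mapDomain orderedWord) = orderedSum S c := by
  rw [← orderedHom_apply]
  induction c using Finsupp.induction_linear with
  | zero => simp
  | add f g hf hg => rw [Finsupp.mapDomain_add, map_add, hf, hg, map_add]
  | single k a =>
    rw [Finsupp.mapDomain_single, evalHom_single, prod_map_orderedWord, orderedHom_single]

theorem HasOrderedBasis.reorderingConsistent {S : Set (Words Λ)} (h : HasOrderedBasis S) :
    ReorderingConsistent S := by
  intro x y t g₁ g₂ h₁ o₁ h₂ o₂
  have e₁ := (isRealization S).evalHom_reflTransGen_step h₁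
  have e₂ := (isRealization S).evalHom_reflTransGen_step h₂
  obtain ⟨c₁, rfl⟩ := exists_mapDomain_orderedWord o₁
  obtain ⟨c₂, rfl⟩ := exists_mapDomain_orderedWord o₂
  rw [evalHom_mapDomain_orderedWord] at e₁ e₂
  rw [h.1 (e₁.trans e₂.symm)]

section Surjective

variable {S}

theorem coefHom_mul_mem_range_orderedHom (a : Λ) {y : Space S} (hy : y ∈ (orderedHom S).range) :
    coefHom S a * y ∈ (orderedHom S).range := by
  obtain ⟨c, rfl⟩ := hy
  induction c using Finsupp.induction_linear with
  | zero => simp [zero_mem]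
  | add f g hf hg => rw [map_add, mul_add]; exact add_mem hf hg
  | single k b =>
    exact ⟨Finsupp.single k (a * b), by simp only [orderedHom_single, map_mul, mul_assoc]⟩

theorem monomial_mem_range_orderedHom (k : ℕ × Fin 2 × ℕ) :
    monomial (z S) k ∈ (orderedHom S).range :=
  ⟨Finsupp.single k 1, by rw [orderedHom_single, map_one, one_mul]⟩

theorem z_mul_mem_range_orderedHom {p : ℂˣ} {r : ℂ} (hz : IsOrderedSuperspace p r (z S))
    (m : SignType) {y : Space S} (hy : y ∈ (orderedHom S).range) :
    z S m * y ∈ (orderedHom S).range := by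
  obtain ⟨c, rfl⟩ := hy
  induction c using Finsupp.induction_linear with
  | zero => simp [zero_mem]
  | add f g hf hg => rw [map_add, mul_add]; exact add_mem hf hg
  | single k b =>
    rw [orderedHom_single, ← mul_assoc, (isRealization S).mul_coef, mul_assoc, mul_monomial hz,
      Finsupp.linearCombination_apply]
    refine coefHom_mul_mem_range_orderedHom _ (sum_mem fun i _ => ?_)
    dsimp only
    rw [Algebra.smul_def, ← (coefHom S).commutes]
    exact coefHom_mul_mem_range_orderedHom _ (monomial_mem_range_orderedHom i)

theorem orderedSum_surjective {p : ℂˣ} {r : ℂ} (hz : IsOrderedSuperspace p r (z S)) :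
    Function.Surjective (orderedSum S) := by
  have mul_mem (x : Space S) : ∀ y ∈ (orderedHom S).range, x * y ∈ (orderedHom S).range := by
    induction x using induction with
    | coef a => exact fun _ => coefHom_mul_mem_range_orderedHom a
    | z m => exact fun _ => z_mul_mem_range_orderedHom hz m
    | add x y hx hy => exact fun w hw => add_mul x y w ▸ add_mem (hx w hw) (hy w hw)
    | mul x y hx hy => exact fun w hw => mul_assoc x y w ▸ hx _ (hy w hw)
  have one_mem : (1 : Space S) ∈ (orderedHom S).range := by
    simpa [monomial] using monomial_mem_range_orderedHom (S := S) (0, 0, 0)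
  exact fun x => mul_one x ▸ mul_mem x 1 one_mem

end Surjective

section Injective

open GradedTensorProduct

variable {p : ℂˣ} {r : ℂ}

variable (Λ) in
theorem isRealization_gradedTensorProduct (hp : (p : ℂ)⁻¹ + p ≠ 0) (r : ℂ) :
    IsRealization (relators p r (0 : Λ)) (includeLeft (part Λ) (part (Superspace p r)))
      (includeRight (part Λ) (part (Superspace p r)) ∘ Superspace.z p r) where
  mul_coef m a := by
    simp only [Function.comp_apply, includeLeft_apply, includeRight_apply]
    rw [tmul_mul_tmul_of_parity_left _ _ _ (Superspace.parity_z m), one_mul, mul_one]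
    exact (tmul_one_mul_one_tmul (part Λ) (part (Superspace p r)) _ _).symm
  evalHom_eq_zero := (evalHom_relators_zero_iff _ _ p r).2
    ((Superspace.isOrderedSuperspace_z hp r).map _)

/-- The coefficients in `Λ` of an element of `Λ ⊗ Superspace p r` with respect to the ordered
monomials. -/
def gradedCoords (hp : (p : ℂ)⁻¹ + p ≠ 0) (r : ℂ) :
    part Λ ᵍ⊗[ℂ] part (Superspace p r) →ₗ[ℂ] (ℕ × Fin 2 × ℕ →₀ Λ) :=
  (TensorProduct.finsuppScalarRight ℂ ℂ Λ _).toLinearMap ∘ₗ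
    (Superspace.coords hp r).lTensor Λ ∘ₗ
      (GradedTensorProduct.of ℂ (part Λ) (part (Superspace p r))).symm.toLinearMap

theorem gradedCoords_tmul_monomial (hp : (p : ℂ)⁻¹ + p ≠ 0) (r : ℂ) (a : Λ) (k : ℕ × Fin 2 × ℕ) :
    gradedCoords hp r (a ᵍ⊗ₜ[ℂ] monomial (Superspace.z p r) k) = Finsupp.single k a := by
  change TensorProduct.finsuppScalarRight ℂ ℂ Λ _ (a ⊗ₜ[ℂ] Superspace.coords hp r _) = _
  rw [Superspace.coords_monomial, TensorProduct.finsuppScalarRight_apply_tmul]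
  simp

theorem gradedCoords_lift_orderedHom (hp : (p : ℂ)⁻¹ + p ≠ 0) (r : ℂ) (c : ℕ × Fin 2 × ℕ →₀ Λ) :
    gradedCoords hp r (lift (isRealization_gradedTensorProduct Λ hp r) (orderedHom _ c)) = c := by
  induction c using Finsupp.induction_linear with
  | zero => simp
  | add f g hf hg => simp only [map_add, hf, hg]
  | single k a =>
    have h_mon : lift (isRealization_gradedTensorProduct Λ hp r) (monomial (z _) k) =
        1 ᵍ⊗ₜ[ℂ] monomial (Superspace.z p r) k := by
      refine (map_monomial (AlgHom.toRingHom _) _ _).trans ?_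
      refine .trans ?_ (map_monomial (AlgHom.toRingHom (includeRight _ _)) _ _).symm
      exact congrArg (monomial · k) (funext fun m => lift_z _ m)
    rw [orderedHom_single, map_mul, lift_coefHom, h_mon, includeLeft_apply,
      tmul_one_mul_one_tmul, gradedCoords_tmul_monomial]

theorem orderedSum_injective (hp : (p : ℂ)⁻¹ + p ≠ 0) (r : ℂ) :
    Function.Injective (orderedSum (relators p r (0 : Λ))) :=
  Function.LeftInverse.injective (g := fun x => gradedCoords hp r (lift _ x))
    (gradedCoords_lift_orderedHom hp r)

end Injective

variable (Λ) in
theorem hasOrderedBasis_relators_zero {p : ℂˣ} (hp : (p : ℂ)⁻¹ + p ≠ 0) (r : ℂ) :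
    HasOrderedBasis (relators p r (0 : Λ)) :=
  ⟨orderedSum_injective hp r, orderedSum_surjective <|
    (evalHom_relators_zero_iff _ _ p r).1 (isRealization _).evalHom_eq_zero⟩

end Space

section RadiusCommutes

theorem commute_composite_cgZero {B : Type*} [Ring B] [Algebra ℂ B] {p : ℂˣ} {z : SignType → B}
    (h : ∀ M, composite (cgOne p M) z = 0) (m : SignType) :
    Commute (composite (cgZero p) z) (z m) := by
  have hp : (p : ℂ) ≠ 0 := p.ne_zero
  simp only [composite, forall_signType, sum_cgOne_one_smul, sum_cgOne_zero_smul,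
    sum_cgOne_neg_one_smul] at h
  obtain ⟨h1, h0, hm⟩ := h
  have h10 : z 1 * z 0 = (p : ℂ) ^ 2 • (z 0 * z 1) := by
    linear_combination (norm := (match_scalars <;> field_simp <;> ring)) (p : ℂ) • h1
  have h0m : z 0 * z (-1) = (p : ℂ) ^ 2 • (z (-1) * z 0) := by
    linear_combination (norm := (match_scalars <;> field_simp <;> ring)) (-p : ℂ) • hm
  have h1m : z 1 * z (-1) = z (-1) * z 1 + ((p : ℂ)⁻¹ + p) • (z 0 * z 0) := by
    linear_combination (norm := module) (-1 : ℂ) • h0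
  have h10' (y : B) : z 1 * (z 0 * y) = (p : ℂ) ^ 2 • (z 0 * (z 1 * y)) := by
    rw [← mul_assoc, h10, smul_mul_assoc, mul_assoc]
  have h0m' (y : B) : z 0 * (z (-1) * y) = (p : ℂ) ^ 2 • (z (-1) * (z 0 * y)) := by
    rw [← mul_assoc, h0m, smul_mul_assoc, mul_assoc]
  have h1m' (y : B) : z 1 * (z (-1) * y) =
      z (-1) * (z 1 * y) + ((p : ℂ)⁻¹ + p) • (z 0 * (z 0 * y)) := by
    rw [← mul_assoc, h1m, add_mul, smul_mul_assoc, mul_assoc, mul_assoc]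
  revert m
  simp only [composite, sum_cgZero_smul, forall_signType]
  simp only [Commute, SemiconjBy, add_mul, sub_mul, mul_add, mul_sub, smul_mul_assoc,
    mul_smul_comm, mul_assoc, h10, h0m, h1m, h10', h0m', h1m', smul_add, smul_smul]
  refine ⟨?_, trivial, ?_⟩ <;> match_scalars <;> field_simp <;> ring

theorem radiusCommutes_zero {Λ : Type*} [Ring Λ] [Algebra ℂ Λ] [SuperAlgebra Λ] (p : ℂˣ) :
    RadiusCommutes p (0 : Λ) := by
  refine commute_composite_cgZero fun M => ?_
  have h := (Space.isRealization (relatorsOne p (0 : Λ))).evalHom_eq_zero _ ⟨M, rfl⟩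
  rwa [evalHom_relatorOne, map_zero, zero_mul, sub_zero] at h

end RadiusCommutes

section Reordering

variable {Λ : Type*} [Ring Λ]

instance : DecidablePred IsOrdered := fun w =>
  inferInstanceAs (Decidable (w.IsChain fun x y => x < y ∨ (x = y ∧ x ≠ 0)))

theorem IsOrderedSum.single {w : List SignType} (hw : IsOrdered w) (c : Λ) :
    IsOrderedSum (Finsupp.single w c) := by
  intro v hv
  rwa [Finset.mem_singleton.1 (Finsupp.support_single_subset hv)]

theorem IsOrderedSum.add {f g : Words Λ} (hf : IsOrderedSum f) (hg : IsOrderedSum g) :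
    IsOrderedSum (f + g) := by
  classical
  intro w hw
  rcases Finset.mem_union.1 (Finsupp.support_add hw) with h | h
  exacts [hf w h, hg w h]

section Rules

variable [Algebra ℂ Λ]

theorem compositeWords_eq_sum_smul (C : SignType × SignType → ℂ) :
    (compositeWords C : Words Λ) = ∑ k, C k • Finsupp.single [k.1, k.2] 1 := by
  simp only [compositeWords, Finsupp.smul_single, Algebra.algebraMap_eq_smul_one]

theorem relatorZero_mem_span (p : ℂˣ) (r : ℂ) (ξ : Λ) :
    relatorZero Λ p r ∈ Submodule.span Λ (relators p r ξ) :=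
  Submodule.subset_span (.inl rfl)

theorem relatorOne_mem_span (p : ℂˣ) (r : ℂ) (ξ : Λ) (M : SignType) :
    relatorOne p ξ M ∈ Submodule.span Λ (relators p r ξ) :=
  Submodule.subset_span (.inr ⟨M, rfl⟩)

theorem isRule_one_zero (p : ℂˣ) (r : ℂ) (ξ : Λ) : IsRule (relators p r ξ) 1 0
    (Finsupp.single [0, 1] (algebraMap ℂ Λ ((p : ℂ) ^ 2)) + Finsupp.single [1] ((p : ℂ) • ξ)) := by
  have hp : (p : ℂ) ≠ 0 := p.ne_zero
  refine ⟨by decide, .add (.single (by decide) _) (.single (by decide) _), ?_⟩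
  convert Submodule.smul_of_tower_mem _ (p : ℂ) (relatorOne_mem_span p r ξ 1) using 1
  rw [relatorOne, compositeWords_eq_sum_smul, sum_cgOne_one_smul, Algebra.algebraMap_eq_smul_one,
    ← Finsupp.smul_single, ← Finsupp.smul_single]
  match_scalars <;> field_simp

theorem isRule_zero_neg_one (p : ℂˣ) (r : ℂ) (ξ : Λ) : IsRule (relators p r ξ) 0 (-1)
    (Finsupp.single [-1, 0] (algebraMap ℂ Λ ((p : ℂ) ^ 2)) +
      Finsupp.single [-1] (-((p : ℂ) • ξ))) := by
  have hp : (p : ℂ) ≠ 0 := p.ne_zero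
  refine ⟨by decide, .add (.single (by decide) _) (.single (by decide) _), ?_⟩
  convert Submodule.smul_of_tower_mem _ (-(p : ℂ)) (relatorOne_mem_span p r ξ (-1)) using 1
  rw [relatorOne, compositeWords_eq_sum_smul, sum_cgOne_neg_one_smul,
    Algebra.algebraMap_eq_smul_one, ← neg_smul, ← Finsupp.smul_single, ← Finsupp.smul_single]
  match_scalars <;> field_simp

theorem isRule_zero_zero (p : ℂˣ) (r : ℂ) (ξ : Λ) : IsRule (relators p r ξ) 0 0
    (Finsupp.single [-1, 1] (algebraMap ℂ Λ ((p : ℂ) ^ 3 - p)) +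
      Finsupp.single [0] ((p : ℂ) • ξ) +
      Finsupp.single [] (algebraMap ℂ Λ (-((p : ℂ) ^ 2 * r)))) := by
  have hp : (p : ℂ) ≠ 0 := p.ne_zero
  refine ⟨by decide, .add (.add (.single (by decide) _) (.single (by decide) _))
    (.single (by decide) _), ?_⟩
  convert add_mem (Submodule.smul_of_tower_mem _ (p : ℂ) (relatorOne_mem_span p r ξ 0))
    (Submodule.smul_of_tower_mem _ (-(p : ℂ) ^ 2) (relatorZero_mem_span p r ξ)) using 1
  simp only [relatorOne, relatorZero, compositeWords_eq_sum_smul, sum_cgOne_zero_smul,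
    sum_cgZero_smul, Algebra.algebraMap_eq_smul_one, ← Finsupp.smul_single]
  match_scalars <;> field_simp <;> ring

end Rules

variable [Algebra ℂ Λ] [SuperAlgebra Λ]

theorem step_single_add {S : Set (Words Λ)} {x y : SignType} {e : Words Λ} (h : IsRule S x y e)
    (u v : List SignType) (c : Λ) {g : Words Λ} (hg : g (u ++ x :: y :: v) = 0) :
    Step S (Finsupp.single (u ++ x :: y :: v) c + g) (g + c • insertWords u v e) := by
  refine ⟨u, v, x, y, e, h, ?_⟩
  rw [Finsupp.erase_add, Finsupp.erase_single, zero_add, Finsupp.add_apply, Finsupp.single_eq_same,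
    hg, add_zero, Finsupp.erase_of_notMem_support (Finsupp.notMem_support_iff.2 hg)]

/- Replacing the left pair in `z_0 z_0 z_0` leaves `b z_0 z_0`, replacing the right pair leaves
`-b z_0 z_0`, because the odd `b` has to be moved past `z_0`. -/
theorem mul_add_mul_eq_neg_of_reorderingConsistent {S : Set (Words Λ)}
    (h : ReorderingConsistent S) {a b c d : Λ} (ha : parity a = a) (hb : parity b = -b)
    (hd : parity d = d)
    (rule_one_zero : IsRule S 1 0 (Finsupp.single [0, 1] c + Finsupp.single [1] b))
    (rule_zero_neg_one : IsRule S 0 (-1) (Finsupp.single [-1, 0] c + Finsupp.single [-1] (-b)))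
    (rule_zero_zero : IsRule S 0 0
      (Finsupp.single [-1, 1] a + Finsupp.single [0] b + Finsupp.single [] d)) :
    a * b + b * a = -(a * b + b * a) := by
  have left₁ := step_single_add rule_zero_zero [] [0] 1 (g := 0) rfl
  have left₂ := step_single_add rule_one_zero [-1] [] a
    (g := Finsupp.single [0, 0] b + Finsupp.single [0] d) (by simp)
  have left₃ := step_single_add rule_zero_zero [] [] b
    (g := Finsupp.single [0] d + Finsupp.single [-1, 0, 1] (a * c) +
      Finsupp.single [-1, 1] (a * b)) (by simp)
  have right₁ := step_single_add rule_zero_zero [0] [] 1 (g := 0) rfl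
  have right₂ := step_single_add rule_zero_neg_one [] [1] a
    (g := Finsupp.single [0, 0] (-b) + Finsupp.single [0] d) (by simp)
  have right₃ := step_single_add rule_zero_zero [] [] (-b)
    (g := Finsupp.single [0] d + Finsupp.single [-1, 0, 1] (a * c) +
      Finsupp.single [-1, 1] (-(a * b))) (by simp)
  simp only [insertWords_add, insertWords_single, smul_add, Finsupp.smul_single, smul_eq_mul,
    List.nil_append, List.append_nil, List.cons_append, List.map_cons, List.map_nil, List.sum_cons,
    List.sum_nil, par_zero, par_neg_one, Function.iterate_zero, Function.iterate_one, id_eq,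
    add_zero, zero_add, ha, hb, hd, one_mul, mul_neg, neg_mul, add_assoc]
    at left₁ left₂ left₃ right₁ right₂ right₃
  have same_result := h 0 0 0 _ _
    (.tail (.tail (.single left₁) left₂) (by convert left₃ using 1)) ?_
    (.tail (.tail (.single right₁) right₂) (by convert right₃ using 1)) ?_
  · simpa [add_comm] using DFunLike.congr_fun same_result [-1, 1]
  all_goals
    repeat' apply IsOrderedSum.add
    all_goals exact .single (by decide) _

theorem eq_zero_of_reorderingConsistent {p : ℂˣ} (hp : (p : ℂ) ^ 2 ≠ 1) {r : ℂ} {ξ : Λ}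
    (hξ : parity ξ = -ξ) (h : ReorderingConsistent (relators p r ξ)) : ξ = 0 := by
  have key := mul_add_mul_eq_neg_of_reorderingConsistent h (AlgHom.commutes _ _)
    (by rw [map_smul, hξ, smul_neg]) (AlgHom.commutes _ _)
    (isRule_one_zero p r ξ) (isRule_zero_neg_one p r ξ) (isRule_zero_zero p r ξ)
  rw [← Algebra.commutes, ← Algebra.smul_def, smul_smul] at key
  have key : (4 * (p : ℂ) ^ 2 * ((p : ℂ) ^ 2 - 1)) • ξ = 0 := by
    linear_combination (norm := (match_scalars; ring)) key
  exact (smul_eq_zero.1 key).resolve_left <|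
    mul_ne_zero (mul_ne_zero (by norm_num) (pow_ne_zero _ p.ne_zero)) (sub_ne_zero.2 hp)

theorem reorderingConsistent_relators_iff {p : ℂˣ} (hp : p ^ 4 ≠ 1) (r : ℂ) {ξ : Λ}
    (hξ : parity ξ = -ξ) : ReorderingConsistent (relators p r ξ) ↔ ξ = 0 := by
  refine ⟨eq_zero_of_reorderingConsistent (pow_ne_one_of_dvd hp (by norm_num)) hξ, ?_⟩
  rintro rfl
  exact (Space.hasOrderedBasis_relators_zero Λ (inv_add_self_ne_zero hp) r).reorderingConsistent

theorem consistent_iff {p : ℂˣ} (hp : p ^ 4 ≠ 1) (r : ℂ) {ξ : Λ} (hξ : parity ξ = -ξ) :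
    Consistent p r ξ ↔ ξ = 0 := by
  rw [Consistent, reorderingConsistent_relators_iff hp r hξ]
  exact and_iff_right_of_imp fun h => h ▸ radiusCommutes_zero p

theorem hasOrderedBasis_relators_iff {p : ℂˣ} (hp : p ^ 4 ≠ 1) (r : ℂ) {ξ : Λ}
    (hξ : parity ξ = -ξ) : Space.HasOrderedBasis (relators p r ξ) ↔ ξ = 0 := by
  refine ⟨fun h => (reorderingConsistent_relators_iff hp r hξ).1 h.reorderingConsistent, ?_⟩
  rintro rfl
  exact Space.hasOrderedBasis_relators_zero Λ (inv_add_self_ne_zero hp) r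

end Reordering

section TensorSquare

open GradedTensorProduct U
open scoped Kronecker

theorem graded_parity_induction {A B : Type*} [Ring A] [Algebra ℂ A] [SuperAlgebra A] [Ring B]
    [Algebra ℂ B] [SuperAlgebra B] {P : part A ᵍ⊗[ℂ] part B → Prop} (zero : P 0)
    (tmul : ∀ (m n : ℕ) (a : A) (b : B), parity a = (-1 : ℂ) ^ m • a →
      parity b = (-1 : ℂ) ^ n • b → P (a ᵍ⊗ₜ[ℂ] b))
    (add : ∀ x y, P x → P y → P (x + y)) (Z : part A ᵍ⊗[ℂ] part B) : P Z := by
  refine graded_induction zero (fun a b => ?_) add Z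
  induction a using parity_induction with
  | add a₁ a₂ h₁ h₂ =>
    rw [GradedTensorProduct.tmul, TensorProduct.add_tmul, map_add]
    exact add _ _ h₁ h₂
  | hom m a ha =>
    induction b using parity_induction with
    | add b₁ b₂ h₁ h₂ =>
      rw [GradedTensorProduct.tmul, TensorProduct.tmul_add, map_add]
      exact add _ _ h₁ h₂
    | hom n b hb => exact tmul m n a b ha hb

/-- The parity operator `z_m ↦ (-1)^|z_m| z_m` of the three-dimensional representation. -/
def parityMatrix : Matrix SignType SignType ℂ := Matrix.diagonal fun m => (-1) ^ par m

theorem parityMatrix_pow (n : ℕ) :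
    parityMatrix ^ n = Matrix.diagonal fun m => (-1) ^ (n * par m) := by
  rw [parityMatrix, Matrix.diagonal_pow]
  congr 1
  ext m
  rw [Pi.pow_apply, ← pow_mul, mul_comm]

variable (p : ℂˣ)

theorem rep_iterate_parity (n : ℕ) (X : U p) (i j : SignType) :
    rep p (((parity : U p →ₐ[ℂ] U p) ^ n) X) i j =
      (-1) ^ (n * (par i + par j)) * rep p X i j := by
  induction n with
  | zero => rw [zero_mul, pow_zero, pow_zero, one_mul, AlgHom.one_apply]
  | succ n ih =>
    rw [pow_succ', AlgHom.mul_apply, rep_parity, ih, ← mul_assoc, ← pow_add]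
    congr 2
    ring

variable {p} in
theorem parityMatrix_pow_mul_rep {X : U p} {m : ℕ} (hX : parity X = (-1 : ℂ) ^ m • X) (n : ℕ) :
    parityMatrix ^ n * rep p X = (-1 : ℂ) ^ (n * m) • (rep p X * parityMatrix ^ n) := by
  ext i j
  have h := rep_parity p X i j
  rw [hX, map_smul, Matrix.smul_apply, smul_eq_mul, mul_eq_mul_right_iff] at h
  rw [parityMatrix_pow, Matrix.smul_apply, Matrix.diagonal_mul, Matrix.mul_diagonal, smul_eq_mul]
  rcases h with h | h
  · have hnm : (-1 : ℂ) ^ (n * m) = (-1) ^ (n * par i) * (-1) ^ (n * par j) := by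
      rw [mul_comm, pow_mul, h, ← pow_mul, mul_comm, mul_add, pow_add]
    have hj : (-1 : ℂ) ^ (n * par j) * (-1) ^ (n * par j) = 1 := by
      rw [← mul_pow, neg_one_mul, neg_neg, one_pow]
    rw [hnm]
    linear_combination (-(-1) ^ (n * par i) * rep p X i j) * hj
  · rw [h, mul_zero, zero_mul, mul_zero]

/-- The action `(x ⊗ y) (z_i ⊗ z_j) = (-1)^(|y| |z_i|) x z_i ⊗ y z_j` of graded tensors on the
tensor square of the representation. -/
def gradedRep : part (U p) ᵍ⊗[ℂ] part (U p) →ₗ[ℂ]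
    Matrix (SignType × SignType) (SignType × SignType) ℂ :=
  LinearMap.pi fun k' => LinearMap.pi fun k =>
    LinearMap.mul' ℂ ℂ ∘ₗ TensorProduct.map
      (Matrix.entryLinearMap ℂ ℂ k'.1 k.1 ∘ₗ (rep p).toLinearMap)
      (Matrix.entryLinearMap ℂ ℂ k'.2 k.2 ∘ₗ (rep p).toLinearMap ∘ₗ
        ((parity : U p →ₐ[ℂ] U p) ^ par k.1).toLinearMap) ∘ₗ
      (GradedTensorProduct.of ℂ (part (U p)) (part (U p))).symm.toLinearMap

theorem gradedRep_tmul_apply (x y : U p) (k' k : SignType × SignType) :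
    gradedRep p (x ᵍ⊗ₜ[ℂ] y) k' k = (-1) ^ (par k.1 * (par k'.2 + par k.2)) *
      (rep p x k'.1 k.1 * rep p y k'.2 k.2) := by
  rw [mul_left_comm, ← rep_iterate_parity]
  rfl

variable {p} in
theorem gradedRep_tmul_of_parity (x : U p) {y : U p} {n : ℕ} (hy : parity y = (-1 : ℂ) ^ n • y) :
    gradedRep p (x ᵍ⊗ₜ[ℂ] y) = (rep p x * parityMatrix ^ n) ⊗ₖ rep p y := by
  ext k' k
  have h := rep_parity p y k'.2 k.2
  rw [hy, map_smul, Matrix.smul_apply, smul_eq_mul, mul_eq_mul_right_iff] at h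
  rw [gradedRep_tmul_apply, Matrix.kronecker_apply, parityMatrix_pow, Matrix.mul_diagonal]
  rcases h with h | h
  · rw [mul_comm (par k.1), pow_mul, pow_mul, h]
    ring
  · rw [h, mul_zero, mul_zero, mul_zero]

theorem gradedRep_one : gradedRep p 1 = 1 := by
  have h := gradedRep_tmul_of_parity (p := p) 1 (y := 1) (n := 0) (by
    rw [map_one, pow_zero, one_smul])
  rw [map_one, pow_zero, mul_one, Matrix.one_kronecker_one] at h
  exact h

theorem gradedRep_mul (Z W : part (U p) ᵍ⊗[ℂ] part (U p)) :
    gradedRep p (Z * W) = gradedRep p Z * gradedRep p W := by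
  induction Z using graded_parity_induction with
  | zero => rw [zero_mul, map_zero, zero_mul]
  | add x y hx hy => rw [add_mul, map_add, hx, hy, map_add, add_mul]
  | tmul _ n x y _ hy =>
    induction W using graded_parity_induction with
    | zero => rw [mul_zero, map_zero, mul_zero]
    | add x y hx hy => rw [mul_add, map_add, hx, hy, map_add, mul_add]
    | tmul m n' x' y' hx' hy' =>
      have hyy : parity (y * y') = (-1 : ℂ) ^ (n + n') • (y * y') := by
        rw [map_mul, hy, hy', smul_mul_smul_comm, pow_add]
      rw [tmul_mul_tmul_of_parity x y' hy hx', map_smul, gradedRep_tmul_of_parity _ hyy,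
        gradedRep_tmul_of_parity x hy, gradedRep_tmul_of_parity x' hy', ← Matrix.mul_kronecker_mul,
        ← map_mul, mul_assoc (rep p x), ← mul_assoc _ (rep p x'), parityMatrix_pow_mul_rep hx',
        map_mul, pow_add, Matrix.smul_mul, Matrix.mul_smul, Matrix.smul_kronecker]
      simp only [mul_assoc]

/-- `tensorRep` as a homomorphism of algebras. -/
def tensorRepHom : U p →ₐ[ℂ] Matrix (SignType × SignType) (SignType × SignType) ℂ :=
  (AlgHom.ofLinearMap (gradedRep p) (gradedRep_one p) (gradedRep_mul p)).comp (coprod p)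

theorem tensorRep_eq_gradedRep (X : U p) : tensorRep p X = gradedRep p (coprod p X) := rfl

theorem tensorRep_eq_tensorRepHom (X : U p) : tensorRep p X = tensorRepHom p X := rfl

variable {p}

theorem tensorRep_gen_of_even {g : UGen} (hg : g.par = 0) :
    tensorRep p (gen p g) = repGen p g ⊗ₖ repGen p g := by
  have h : coprodGen p g = gen p g ᵍ⊗ₜ[ℂ] gen p g := by
    cases g <;> first | rfl | cases hg
  rw [tensorRep_eq_gradedRep, coprod_gen, h, gradedRep_tmul_of_parity _ (parity_gen g), rep_gen,
    hg, pow_zero, mul_one]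

theorem tensorRep_gen_of_odd {g : UGen} (hg : g.par = 1) : tensorRep p (gen p g) =
    repGen p g ⊗ₖ repGen p .Kinv + (repGen p .K * parityMatrix) ⊗ₖ repGen p g := by
  have h : coprodGen p g = gen p g ᵍ⊗ₜ[ℂ] gen p .Kinv + gen p .K ᵍ⊗ₜ[ℂ] gen p g := by
    cases g <;> first | rfl | cases hg
  rw [tensorRep_eq_gradedRep, coprod_gen, h, map_add, gradedRep_tmul_of_parity _ (parity_gen g),
    gradedRep_tmul_of_parity _ (parity_gen .Kinv), hg, UGen.par, pow_zero, pow_one, mul_one,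
    rep_gen, rep_gen, rep_gen]

open scoped Matrix in
theorem tensorRep_gen_mulVec_of_even {g : UGen} (hg : g.par = 0) (C : SignType × SignType → ℂ)
    (i j : SignType) :
    (tensorRep p (gen p g) *ᵥ C) (i, j) = repGen p g i i * repGen p g j j * C (i, j) := by
  obtain ⟨d, hd⟩ : ∃ d, repGen p g = Matrix.diagonal d := by
    cases g <;> first | exact ⟨_, rfl⟩ | cases hg
  rw [tensorRep_gen_of_even hg, hd, Matrix.diagonal_kronecker_diagonal, Matrix.mulVec_diagonal,
    Matrix.diagonal_apply_eq, Matrix.diagonal_apply_eq]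

open scoped Matrix in
theorem tensorRep_gen_mulVec_of_odd {g : UGen} (hg : g.par = 1) (C : SignType × SignType → ℂ)
    (i j : SignType) :
    (tensorRep p (gen p g) *ᵥ C) (i, j) =
      (p : ℂ) ^ (-(j : ℤ)) * ∑ i', repGen p g i i' * C (i', j) +
        (p : ℂ) ^ (i : ℤ) * (-1) ^ par i * ∑ j', repGen p g j j' * C (i, j') := by
  have hK : repGen p .K = Matrix.diagonal fun m : SignType => (p : ℂ) ^ (m : ℤ) := rfl
  have hKinv : repGen p .Kinv = Matrix.diagonal fun m : SignType => (p : ℂ) ^ (-(m : ℤ)) := rfl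
  rw [tensorRep_gen_of_odd hg, Matrix.add_mulVec, Pi.add_apply, hK, hKinv, parityMatrix,
    Matrix.diagonal_mul_diagonal]
  simp only [Matrix.mulVec, dotProduct, Fintype.sum_prod_type, Matrix.kroneckerMap_apply,
    Matrix.diagonal_apply, mul_ite, ite_mul, mul_zero, zero_mul, Finset.sum_ite_irrel,
    Finset.sum_ite_eq, Finset.mem_univ, if_true, Finset.mul_sum, Finset.sum_const_zero]
  congr 1 <;> exact Finset.sum_congr rfl fun _ _ => by ring

end TensorSquare

section CoupledVectors

open U
open scoped Matrix

variable {p : ℂˣ}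

variable (p) in
/-- The constant `κ = (q - q⁻¹) / (q⁴ - q⁻⁴)` of the representation. -/
def kappa : ℂ := ((p : ℂ) ^ 2 - ((p : ℂ) ^ 2)⁻¹) / ((p : ℂ) ^ 8 - ((p : ℂ) ^ 8)⁻¹)

theorem repGen_vp : repGen p .vp = Matrix.of fun
    | .pos, .zero => -kappa p
    | .zero, .neg => -kappa p
    | _, _ => 0 := rfl

theorem counit_gen (g : UGen) : counit p (gen p g) = if g.par = 0 then 1 else 0 := by
  rw [counit, U.lift_gen]
  cases g <;> rfl

theorem isCoupledZero_iff_forall_gen {C : SignType × SignType → ℂ} :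
    IsCoupledZero p C ↔ ∀ g, tensorRep p (gen p g) *ᵥ C = counit p (gen p g) • C := by
  refine ⟨fun h g => h _, fun h X => ?_⟩
  simp only [tensorRep_eq_tensorRepHom] at h ⊢
  induction X using U.induction with
  | gen g => exact h g
  | scalar c =>
    rw [AlgHom.commutes, AlgHom.commutes, Algebra.algebraMap_eq_smul_one, Matrix.smul_mulVec,
      Matrix.one_mulVec, Algebra.algebraMap_self_apply]
  | add X Y hX hY => simp only [map_add, Matrix.add_mulVec, add_smul, hX, hY]
  | mul X Y hX hY =>
    rw [map_mul, ← Matrix.mulVec_mulVec, hY, Matrix.mulVec_smul, hX, smul_smul, map_mul, mul_comm]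

theorem isCoupledOne_iff_forall_gen {C : SignType → SignType × SignType → ℂ} :
    IsCoupledOne p C ↔ ∀ g M, tensorRep p (gen p g) *ᵥ C M = ∑ M', repGen p g M' M • C M' := by
  refine ⟨fun h g M => by rw [h, rep_gen], fun h X => ?_⟩
  simp only [tensorRep_eq_tensorRepHom, ← rep_gen] at h ⊢
  induction X using U.induction with
  | gen g => exact h g
  | scalar c =>
    intro M
    rw [AlgHom.commutes, AlgHom.commutes, Algebra.algebraMap_eq_smul_one, Matrix.smul_mulVec,
      Matrix.one_mulVec]
    simp only [Algebra.algebraMap_eq_smul_one, Matrix.smul_apply, Matrix.one_apply, smul_eq_mul,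
      mul_ite, mul_one, mul_zero, ite_smul, zero_smul, Finset.sum_ite_eq', Finset.mem_univ, if_true]
  | add X Y hX hY =>
    intro M
    simp only [map_add, Matrix.add_mulVec, Matrix.add_apply, add_smul, Finset.sum_add_distrib,
      hX, hY]
  | mul X Y hX hY =>
    intro M
    rw [map_mul, ← Matrix.mulVec_mulVec, hY, Matrix.mulVec_sum]
    simp only [Matrix.mulVec_smul, hX, map_mul, Matrix.mul_apply, Finset.sum_smul,
      Finset.smul_sum, smul_smul]
    rw [Finset.sum_comm]
    simp only [mul_comm]

theorem isCoupledZero_cgZero : IsCoupledZero p (cgZero p) := by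
  have hp : (p : ℂ) ≠ 0 := p.ne_zero
  refine isCoupledZero_iff_forall_gen.2 fun g => ?_
  rw [counit_gen]
  ext ⟨i, j⟩
  cases g
  case K | Kinv =>
    rw [tensorRep_gen_mulVec_of_even rfl]
    cases i <;> cases j <;> simp [repGen, cgZero, UGen.par, hp]
  case vp =>
    rw [tensorRep_gen_mulVec_of_odd rfl, sum_sign, sum_sign, repGen_vp]
    cases i <;> cases j <;> simp [cgZero, UGen.par, par, hp, mul_comm (kappa p)]
  case vm =>
    rw [tensorRep_gen_mulVec_of_odd rfl, sum_sign, sum_sign, repGen]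
    cases i <;> cases j <;> simp [cgZero, UGen.par, par, hp]

theorem isCoupledOne_cgOne : IsCoupledOne p (cgOne p) := by
  have hp : (p : ℂ) ≠ 0 := p.ne_zero
  refine isCoupledOne_iff_forall_gen.2 fun g M => ?_
  ext ⟨i, j⟩
  rw [sum_sign]
  cases g
  case K | Kinv =>
    rw [tensorRep_gen_mulVec_of_even rfl]
    cases M <;> cases i <;> cases j <;> simp [repGen, cgOne, hp]
  case vp =>
    rw [tensorRep_gen_mulVec_of_odd rfl, sum_sign, sum_sign, repGen_vp]
    cases M <;> cases i <;> cases j <;> simp [cgOne, par, hp, mul_comm (kappa p), add_mul]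
  case vm =>
    rw [tensorRep_gen_mulVec_of_odd rfl, sum_sign, sum_sign, repGen]
    cases M <;> cases i <;> cases j <;> simp [cgOne, par, hp]

theorem tensorRep_K_mulVec (C : SignType × SignType → ℂ) (i j : SignType) :
    (tensorRep p (gen p .K) *ᵥ C) (i, j) = (p : ℂ) ^ ((i : ℤ) + j) * C (i, j) := by
  rw [tensorRep_gen_mulVec_of_even rfl, repGen, Matrix.diagonal_apply_eq, Matrix.diagonal_apply_eq,
    zpow_add₀ p.ne_zero]

theorem eq_zero_of_zpow_mul_eq {n : ℕ} (hp : p ^ n ≠ 1) {a b : ℤ} (hab : a - b ∣ n) {c : ℂ}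
    (h : (p : ℂ) ^ a * c = (p : ℂ) ^ b * c) : c = 0 := by
  refine (mul_eq_mul_right_iff.1 h).resolve_left fun h => hp ?_
  rw [← Units.val_zpow_eq_zpow_val, ← Units.val_zpow_eq_zpow_val, Units.val_inj] at h
  obtain ⟨d, hd⟩ := hab
  rw [← zpow_natCast, hd, zpow_mul, zpow_sub, h, mul_inv_cancel, one_zpow]

theorem IsCoupledZero.smul {C : SignType × SignType → ℂ} (hC : IsCoupledZero p C) (c : ℂ) :
    IsCoupledZero p (c • C) := fun X => by
  rw [Matrix.mulVec_smul, hC, smul_comm]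

theorem IsCoupledZero.apply_eq_zero {C : SignType × SignType → ℂ} (hC : IsCoupledZero p C)
    {n : ℕ} (hp : p ^ n ≠ 1) {i j : SignType} (hij : (i : ℤ) + j ∣ n) : C (i, j) = 0 := by
  have hK := congrFun (hC (gen p .K)) (i, j)
  rw [tensorRep_K_mulVec, counit_gen, if_pos (show UGen.par .K = 0 from rfl),
    one_smul] at hK
  refine eq_zero_of_zpow_mul_eq (a := (i : ℤ) + j) (b := 0) hp ?_ ?_
  · rwa [sub_zero]
  · rwa [zpow_zero, one_mul]

theorem IsCoupledZero.vm_mulVec {C : SignType × SignType → ℂ} (hC : IsCoupledZero p C) :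
    tensorRep p (gen p .vm) *ᵥ C = 0 := by
  rw [hC, counit_gen, if_neg (by decide), zero_smul]

theorem isCoupledZero_iff (hp : p ^ 2 ≠ 1) {C : SignType × SignType → ℂ} :
    IsCoupledZero p C ↔ ∃ c : ℂ, C = c • cgZero p := by
  refine ⟨fun hC => ⟨C (0, 0), ?_⟩, fun ⟨c, h⟩ => h ▸ isCoupledZero_cgZero.smul c⟩
  have h0 : (p : ℂ) ≠ 0 := p.ne_zero
  have hneg : C (-1, 1) = C (0, 0) * p := by
    have h : -C (0, 0) + (p : ℂ)⁻¹ * C (-1, 1) = 0 := by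
      have h := congrFun hC.vm_mulVec (-1, 0)
      rw [tensorRep_gen_mulVec_of_odd rfl, sum_sign, sum_sign] at h
      simpa [repGen, par] using h
    field_simp at h
    linear_combination h
  have hpos : C (1, -1) = C (0, 0) * -(p : ℂ)⁻¹ := by
    have h : p * C (1, -1) + C (0, 0) = 0 := by
      have h := congrFun hC.vm_mulVec (0, -1)
      rw [tensorRep_gen_mulVec_of_odd rfl, sum_sign, sum_sign] at h
      simpa [repGen, par] using h
    field_simp
    linear_combination h
  ext ⟨i, j⟩
  match i, j with
  | .neg, .pos => exact hneg
  | .zero, .zero => exact (mul_one _).symm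
  | .pos, .neg => exact hpos
  | .neg, .neg | .neg, .zero | .zero, .neg | .zero, .pos | .pos, .zero | .pos, .pos =>
    exact (hC.apply_eq_zero hp (by decide)).trans (mul_zero _).symm

theorem kappa_ne_zero (hp : p ^ 16 ≠ 1) : kappa p ≠ 0 := by
  have h0 : (p : ℂ) ≠ 0 := p.ne_zero
  refine div_ne_zero (fun h => pow_ne_one_of_dvd hp (k := 4) (by decide) ?_)
    fun h => pow_ne_one_of_dvd hp dvd_rfl ?_
  all_goals
    field_simp at h
    linear_combination h

theorem IsCoupledOne.smul {C : SignType → SignType × SignType → ℂ} (hC : IsCoupledOne p C)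
    (c : ℂ) : IsCoupledOne p (c • C) := fun X M => by
  simp only [Pi.smul_apply, Matrix.mulVec_smul, hC X M, Finset.smul_sum, smul_comm c]

theorem IsCoupledOne.gen_mulVec_one {C : SignType → SignType × SignType → ℂ}
    (hC : IsCoupledOne p C) : tensorRep p (gen p .K) *ᵥ C 1 = (p : ℂ) • C 1 ∧
      tensorRep p (gen p .vp) *ᵥ C 1 = 0 ∧ tensorRep p (gen p .vm) *ᵥ C 1 = C 0 ∧
      tensorRep p (gen p .vm) *ᵥ C 0 = -C (-1) := by
  rw [hC, hC, hC, hC, rep_gen, rep_gen, rep_gen]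
  simp [repGen, sum_sign]

theorem IsCoupledOne.ext_one {C D : SignType → SignType × SignType → ℂ} (hC : IsCoupledOne p C)
    (hD : IsCoupledOne p D) (h : C 1 = D 1) : C = D := by
  obtain ⟨-, -, hC0, hC1⟩ := hC.gen_mulVec_one
  obtain ⟨-, -, hD0, hD1⟩ := hD.gen_mulVec_one
  have h0 : C 0 = D 0 := by rw [← hC0, h, hD0]
  refine funext (forall_signType.2 ⟨h, h0, ?_⟩)
  rw [← neg_inj, ← hC1, h0, hD1]

theorem IsCoupledOne.one_eq_smul {C : SignType → SignType × SignType → ℂ} (hC : IsCoupledOne p C)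
    (hp : p ^ 16 ≠ 1) : C 1 = (p * C 1 (1, 0)) • cgOne p 1 := by
  have h0 : (p : ℂ) ≠ 0 := p.ne_zero
  have hκ := kappa_ne_zero hp
  obtain ⟨hK, hvp, -⟩ := hC.gen_mulVec_one
  have hweight : ∀ i j : SignType, (i : ℤ) + j - 1 ∣ (16 : ℕ) → C 1 (i, j) = 0 := fun i j hij =>
    eq_zero_of_zpow_mul_eq hp hij <| by
      rw [← tensorRep_K_mulVec, hK, zpow_one, Pi.smul_apply, smul_eq_mul]
  -- The weight of `(-1, -1)` differs from that of `C 1` by `-3`, and `p ^ 3 = 1` is not excluded.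
  have hneg : C 1 (-1, -1) = 0 := by
    have h := congrFun hvp (0, -1)
    rw [tensorRep_gen_mulVec_of_odd rfl, sum_sign, sum_sign, repGen_vp] at h
    simpa [hκ, h0] using h
  have hpos : C 1 (0, 1) = p * C 1 (1, 0) * -(p : ℂ) := by
    have h : -((p : ℂ)⁻¹ * (kappa p * C 1 (0, 1))) + -(p * (kappa p * C 1 (1, 0))) = 0 := by
      have h := congrFun hvp (1, 1)
      rw [tensorRep_gen_mulVec_of_odd rfl, sum_sign, sum_sign, repGen_vp] at h
      simpa [par] using h
    field_simp at h
    refine mul_left_cancel₀ hκ ?_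
    linear_combination -h
  ext ⟨i, j⟩
  match i, j with
  | .zero, .pos => exact hpos
  | .pos, .zero => exact ((mul_inv_eq_iff_eq_mul₀ h0).2 (mul_comm _ _)).symm
  | .neg, .neg => exact hneg.trans (mul_zero _).symm
  | .neg, .zero | .neg, .pos | .zero, .neg | .zero, .zero | .pos, .neg | .pos, .pos =>
    exact (hweight _ _ (by decide)).trans (mul_zero _).symm

theorem isCoupledOne_iff (hp : p ^ 16 ≠ 1) {C : SignType → SignType × SignType → ℂ} :
    IsCoupledOne p C ↔ ∃ c : ℂ, C = c • cgOne p := by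
  refine ⟨fun hC => ⟨_, hC.ext_one (isCoupledOne_cgOne.smul _) (hC.one_eq_smul hp)⟩, ?_⟩
  rintro ⟨c, rfl⟩
  exact isCoupledOne_cgOne.smul c

end CoupledVectors

section Pairing

open GradedTensorProduct U

/-- The contraction `a ⊗ b ↦ ε(b) a` of the second factor of a graded tensor product with an even
character. -/
def contractRight {A B : Type*} [Ring A] [Algebra ℂ A] [SuperAlgebra A] [Ring B] [Algebra ℂ B]
    [SuperAlgebra B] (ε : B →ₐ[ℂ] ℂ) (hε : ∀ b, ε (parity b) = ε b) :
    part A ᵍ⊗[ℂ] part B →ₐ[ℂ] A :=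
  GradedTensorProduct.lift (part A) (part B) (AlgHom.id ℂ A) ((Algebra.ofId ℂ A).comp ε) (by
    rintro i j ⟨a, ha⟩ ⟨b, hb⟩
    have hj : ∀ j : ZMod 2, j = 0 ∨ j = 1 := by decide
    obtain rfl | rfl := hj j
    · simp [Algebra.ofId_apply, Algebra.commutes]
    · have h := hε b
      rw [mem_part_one.1 hb, map_neg] at h
      simp only [AlgHom.comp_apply, self_eq_neg.1 h.symm, map_zero, mul_zero, zero_mul]
      exact (smul_zero _).symm)

theorem contractRight_tmul {A B : Type*} [Ring A] [Algebra ℂ A] [SuperAlgebra A] [Ring B]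
    [Algebra ℂ B] [SuperAlgebra B] (ε : B →ₐ[ℂ] ℂ) (hε : ∀ b, ε (parity b) = ε b) (a : A) (b : B) :
    contractRight ε hε (a ᵍ⊗ₜ[ℂ] b) = ε b • a := by
  rw [Algebra.smul_def, Algebra.commutes]
  exact lift_tmul _ _ _ _ _ a b

variable (p : ℂˣ)

theorem contractRight_coprod (X : U p) :
    contractRight (counit p) (counit_parity p) (coprod p X) = X := by
  have h : (contractRight (counit p) (counit_parity p)).comp (coprod p) = AlgHom.id ℂ (U p) := by
    refine U.hom_ext fun g => ?_
    rw [AlgHom.comp_apply, coprod_gen]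
    cases g <;> simp [coprodGen, contractRight_tmul, counit_gen, UGen.par]
  exact DFunLike.congr_fun h X

theorem conv_counit (n : ℕ) (f : U p →ₗ[ℂ] ℂ) : conv p n f (counit p).toLinearMap = f := by
  ext X
  conv_rhs => rw [← contractRight_coprod p X]
  rw [conv, LinearMap.comp_apply, LinearMap.comp_apply, LinearMap.comp_apply,
    AlgHom.toLinearMap_apply]
  induction coprod p X using graded_induction with
  | zero => simp only [map_zero]
  | add x y hx hy => simp only [map_add, hx, hy]
  | tmul x y =>
    have hε : counit p (((parity : U p →ₐ[ℂ] U p) ^ n) y) = counit p y := by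
      induction n with
      | zero => rfl
      | succ n ih => rw [pow_succ', AlgHom.mul_apply, counit_parity, ih]
    rw [contractRight_tmul, map_smul, smul_eq_mul, mul_comm, ← hε]
    rfl

theorem pairing_ι (t : SignType × SignType) :
    pairing p (FreeAlgebra.ι ℂ t) = matrixCoeff p t.1 t.2 := by
  rw [pairing, FreeAlgebra.lift_ι_apply]
  exact conv_counit p _ _

theorem matrixCoeff_apply (i j : SignType) (X : U p) :
    matrixCoeff p i j X = (-1) ^ (par i * (par i + par j)) * rep p X i j := by
  rw [← rep_iterate_parity]
  rfl

theorem pairing_ι_mul_ι (s t : SignType × SignType) (X : U p) :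
    pairing p (FreeAlgebra.ι ℂ s * FreeAlgebra.ι ℂ t) X =
      (-1) ^ (par s.1 * (par s.1 + par s.2) + (par s.1 + par t.1) * (par t.1 + par t.2)) *
        tensorRep p X (s.1, t.1) (s.2, t.2) := by
  have h : pairing p (FreeAlgebra.ι ℂ s * FreeAlgebra.ι ℂ t) X =
      conv p (par s.1 + par s.2) (matrixCoeff p s.1 s.2) (matrixCoeff p t.1 t.2) X := by
    rw [← pairing_ι p t, pairing, map_mul, Module.End.mul_apply, FreeAlgebra.lift_ι_apply]
    rfl
  rw [h, tensorRep_eq_gradedRep, conv, LinearMap.comp_apply, LinearMap.comp_apply,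
    LinearMap.comp_apply, AlgHom.toLinearMap_apply]
  induction coprod p X using graded_induction with
  | zero => simp only [map_zero, Matrix.zero_apply, mul_zero]
  | add x y hx hy => simp only [map_add, hx, hy, Matrix.add_apply, mul_add]
  | tmul x y =>
    change matrixCoeff p s.1 s.2 x *
      matrixCoeff p t.1 t.2 (((parity : U p →ₐ[ℂ] U p) ^ (par s.1 + par s.2)) y) = _
    rw [gradedRep_tmul_apply, matrixCoeff_apply, matrixCoeff_apply, rep_iterate_parity]
    ring

theorem pairing_algebraMap (c : ℂ) (X : U p) :
    pairing p (algebraMap ℂ _ c) X = c * counit p X := by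
  simp [pairing, Module.algebraMap_end_apply]

theorem pairing_smul (c : ℂ) (f : FreeAlgebra ℂ (SignType × SignType)) (X : U p) :
    pairing p (c • f) X = c * pairing p f X := by
  simp [pairing]

theorem pairing_sum {ι : Type*} (s : Finset ι) (f : ι → FreeAlgebra ℂ (SignType × SignType))
    (X : U p) : pairing p (∑ i ∈ s, f i) X = ∑ i ∈ s, pairing p (f i) X := by
  simp [pairing]

end Pairing

section MatrixEntries

open scoped Matrix

variable (p : ℂˣ)

theorem parity_T (i j : SignType) :
    parity (A.T p i j) = (-1 : ℂ) ^ (par i + par j) • A.T p i j := by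
  rw [A.T]
  refine (quotientParity_mk parT (ARel p) _ _).trans ?_
  rw [freeParity_ι, map_smul, parT]

variable {p}

theorem even_of_cgZero_ne_zero {k : SignType × SignType} (hk : cgZero p k ≠ 0) :
    Even (par k.1 + par k.2) := by
  obtain ⟨i, j⟩ := k
  cases i <;> cases j <;> first | decide | exact absurd rfl hk

theorem even_of_cgOne_ne_zero {M : SignType} {k : SignType × SignType} (hk : cgOne p M k ≠ 0) :
    Even (par k.1 + par k.2 + par M + 1) := by
  obtain ⟨i, j⟩ := k
  cases M <;> cases i <;> cases j <;> first | decide | exact absurd rfl hk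

theorem sum_T_mul_T {C : SignType × SignType → ℂ} {n : ℕ}
    (hC : ∀ k, C k ≠ 0 → Even (par k.1 + par k.2 + n + 1)) {k' : SignType × SignType}
    {f : FreeAlgebra ℂ (SignType × SignType)}
    (hf : ∀ X, pairing p f X = (-1) ^ ((par k'.1 + par k'.2) * n) * (tensorRep p X *ᵥ C) k') :
    ∑ k, C k • (-1 : ℂ) ^ ((par k'.1 + par k.1) * par k'.2) •
      (A.T p k'.1 k.1 * A.T p k'.2 k.2) = RingQuot.mkAlgHom ℂ (ARel p) f := by
  simp only [A.T, ← map_mul, ← map_smul, ← map_sum]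
  refine RingQuot.mkAlgHom_rel ℂ fun X => ?_
  rw [hf, pairing_sum, Matrix.mulVec, dotProduct, Finset.mul_sum]
  refine Finset.sum_congr rfl fun k _ => ?_
  rw [pairing_smul, pairing_smul, pairing_ι_mul_ι, ← mul_assoc ((-1 : ℂ) ^ _), ← pow_add]
  by_cases hk : C k = 0
  · rw [hk, zero_mul, mul_zero, mul_zero]
  · have h := hC k hk
    rw [neg_one_pow_congr (n := (par k'.1 + par k'.2) * n), mul_left_comm, mul_comm (C k)]
    simp only [Nat.even_add, Nat.even_mul, Nat.not_even_one] at h ⊢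
    tauto

theorem sum_cgZero_T_mul_T (k' : SignType × SignType) :
    ∑ k, cgZero p k • (-1 : ℂ) ^ ((par k'.1 + par k.1) * par k'.2) •
      (A.T p k'.1 k.1 * A.T p k'.2 k.2) = cgZero p k' • (1 : A p) := by
  rw [sum_T_mul_T (n := 1) (f := algebraMap ℂ _ (cgZero p k'))
    (fun k hk => (even_of_cgZero_ne_zero hk).add even_two) fun X => ?_, AlgHom.commutes,
    Algebra.algebraMap_eq_smul_one]
  rw [pairing_algebraMap, isCoupledZero_cgZero, Pi.smul_apply, smul_eq_mul, mul_one]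
  by_cases hk' : cgZero p k' = 0
  · rw [hk', zero_mul, mul_zero, mul_zero]
  · rw [(even_of_cgZero_ne_zero hk').neg_one_pow, one_mul, mul_comm]

theorem sum_cgOne_T_mul_T (M : SignType) (k' : SignType × SignType) :
    ∑ k, cgOne p M k • (-1 : ℂ) ^ ((par k'.1 + par k.1) * par k'.2) •
      (A.T p k'.1 k.1 * A.T p k'.2 k.2) = ∑ M', cgOne p M' k' • A.T' p M' M := by
  rw [sum_T_mul_T (fun k => even_of_cgOne_ne_zero)
    (f := ∑ M', cgOne p M' k' • (-1 : ℂ) ^ (par M' + par M) • FreeAlgebra.ι ℂ (M', M))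
    fun X => ?_]
  · simp only [map_sum, map_smul]
    rfl
  rw [pairing_sum, isCoupledOne_cgOne, Finset.sum_apply, Finset.mul_sum]
  refine Finset.sum_congr rfl fun M' _ => ?_
  rw [pairing_smul, pairing_smul, pairing_ι, matrixCoeff_apply, Pi.smul_apply, smul_eq_mul,
    ← mul_assoc ((-1 : ℂ) ^ _), ← pow_add]
  by_cases hM' : cgOne p M' k' = 0
  · rw [hM', zero_mul, mul_zero, mul_zero]
  · have h := even_of_cgOne_ne_zero hM'
    rw [neg_one_pow_congr (n := (par k'.1 + par k'.2) * par M), mul_left_comm,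
      mul_comm (cgOne p M' k')]
    simp only [Nat.even_add, Nat.even_mul, Nat.not_even_one] at h ⊢
    tauto

end MatrixEntries

section Covariance

open GradedTensorProduct

variable {p : ℂˣ} {B : Type*} [Ring B] [Algebra ℂ B] [SuperAlgebra B] {z : SignType → B}

theorem composite_coaction (hz : ∀ m, parity (z m) = (-1 : ℂ) ^ par m • z m)
    (C : SignType × SignType → ℂ) :
    composite C (fun m => ∑ m', z m' ᵍ⊗ₜ[ℂ] A.T p m' m : SignType → part B ᵍ⊗[ℂ] part (A p)) =
      ∑ k' : SignType × SignType, (z k'.1 * z k'.2) ᵍ⊗ₜ[ℂ]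
        (∑ k, C k • (-1 : ℂ) ^ ((par k'.1 + par k.1) * par k'.2) •
          (A.T p k'.1 k.1 * A.T p k'.2 k.2)) := by
  have h : ∀ k : SignType × SignType,
      ((∑ m', z m' ᵍ⊗ₜ[ℂ] A.T p m' k.1) * ∑ m', z m' ᵍ⊗ₜ[ℂ] A.T p m' k.2 :
        part B ᵍ⊗[ℂ] part (A p)) =
      ∑ k' : SignType × SignType, (-1 : ℂ) ^ ((par k'.1 + par k.1) * par k'.2) •
        (z k'.1 * z k'.2) ᵍ⊗ₜ[ℂ] (A.T p k'.1 k.1 * A.T p k'.2 k.2) := by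
    intro k
    rw [Finset.sum_mul_sum, Fintype.sum_prod_type]
    exact Finset.sum_congr rfl fun i _ => Finset.sum_congr rfl fun j _ =>
      tmul_mul_tmul_of_parity _ _ (parity_T p _ _) (hz _)
  simp only [composite, h, Finset.smul_sum]
  rw [Finset.sum_comm]
  simp only [tmul, TensorProduct.tmul_sum, TensorProduct.tmul_smul, map_sum, map_smul]

theorem composite_cgZero_coaction (hz : ∀ m, parity (z m) = (-1 : ℂ) ^ par m • z m) :
    composite (cgZero p)
      (fun m => ∑ m', z m' ᵍ⊗ₜ[ℂ] A.T p m' m : SignType → part B ᵍ⊗[ℂ] part (A p)) =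
      composite (cgZero p) z ᵍ⊗ₜ[ℂ] 1 := by
  rw [composite_coaction hz]
  simp only [sum_cgZero_T_mul_T, composite, tmul, TensorProduct.tmul_smul, TensorProduct.sum_tmul,
    ← TensorProduct.smul_tmul', map_sum, map_smul]

theorem composite_cgOne_coaction (hz : ∀ m, parity (z m) = (-1 : ℂ) ^ par m • z m) (M : SignType) :
    composite (cgOne p M)
      (fun m => ∑ m', z m' ᵍ⊗ₜ[ℂ] A.T p m' m : SignType → part B ᵍ⊗[ℂ] part (A p)) =
      ∑ M', composite (cgOne p M') z ᵍ⊗ₜ[ℂ] A.T' p M' M := by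
  rw [composite_coaction hz]
  simp only [sum_cgOne_T_mul_T, composite, tmul, TensorProduct.tmul_smul, TensorProduct.sum_tmul,
    TensorProduct.tmul_sum, ← TensorProduct.smul_tmul', map_sum, map_smul]
  exact Finset.sum_comm

theorem freeCoaction_composite (C : SignType × SignType → ℂ) :
    freeCoaction p (composite C (FreeAlgebra.ι ℂ)) =
      composite C fun m => ∑ m', FreeAlgebra.ι ℂ m' ᵍ⊗ₜ[ℂ] A.T p m' m := by
  simp only [composite, freeCoaction, map_sum, map_smul, map_mul, FreeAlgebra.lift_ι_apply]

theorem freeCoaction_composite_cgZero :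
    freeCoaction p (composite (cgZero p) (FreeAlgebra.ι ℂ)) =
      composite (cgZero p) (FreeAlgebra.ι ℂ) ᵍ⊗ₜ[ℂ] 1 := by
  rw [freeCoaction_composite]
  exact composite_cgZero_coaction (freeParity_ι par)

theorem freeCoaction_composite_cgOne (M : SignType) :
    freeCoaction p (composite (cgOne p M) (FreeAlgebra.ι ℂ)) =
      ∑ M', composite (cgOne p M') (FreeAlgebra.ι ℂ) ᵍ⊗ₜ[ℂ] A.T' p M' M := by
  rw [freeCoaction_composite]
  exact composite_cgOne_coaction (freeParity_ι par) M

theorem isSuperspace_coaction (hp : (p : ℂ)⁻¹ + p ≠ 0) (r : ℂ) :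
    IsSuperspace p r (fun m => ∑ m', Superspace.z p r m' ᵍ⊗ₜ[ℂ] A.T p m' m :
      SignType → part (Superspace p r) ᵍ⊗[ℂ] part (A p)) := by
  obtain ⟨hzero, hone⟩ :=
    (composite_eq_iff_isSuperspace hp r _).2 (Superspace.isSuperspace_z p r)
  rw [← composite_eq_iff_isSuperspace hp, composite_cgZero_coaction Superspace.parity_z, hzero]
  refine ⟨rfl, fun M => ?_⟩
  rw [composite_cgOne_coaction Superspace.parity_z]
  simp only [hone, tmul, TensorProduct.zero_tmul, map_zero, Finset.sum_const_zero]

end Covariance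

end OSpq

end

open OSpq OSpq.SuperAlgebra GradedTensorProduct TensorProduct in
theorem mainTheorem3_general {Λ : Type*} [Ring Λ] [Algebra ℂ Λ] [SuperAlgebra Λ]
    {p : ℂˣ} (hp : p ^ 16 ≠ 1) (r : ℂ) {ξ : Λ} (hξ : parity ξ = -ξ) :
    (∀ C, IsCoupledZero p C ↔ ∃ c : ℂ, C = c • cgZero p) ∧
    (∀ C, IsCoupledOne p C ↔ ∃ c : ℂ, C = c • cgOne p) ∧
    freeCoaction p (composite (cgZero p) (FreeAlgebra.ι ℂ)) =
      composite (cgZero p) (FreeAlgebra.ι ℂ) ᵍ⊗ₜ[ℂ] 1 ∧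
    (∀ M, freeCoaction p (composite (cgOne p M) (FreeAlgebra.ι ℂ)) =
      ∑ M', composite (cgOne p M') (FreeAlgebra.ι ℂ) ᵍ⊗ₜ[ℂ] A.T' p M' M) ∧
    (Consistent p r ξ ↔ ξ = 0) ∧
    (ReorderingConsistent (relators p r ξ) ↔ ξ = 0) ∧
    (Space.HasOrderedBasis (relators p r ξ) ↔ ξ = 0) ∧
    (∀ {B : Type*} [Ring B] [Algebra ℂ B] (z : SignType → B),
      (composite (cgZero p) z = algebraMap ℂ B r ∧ ∀ M, composite (cgOne p M) z = 0) ↔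
        IsSuperspace p r z) ∧
    ∃ φ : Superspace p r →ₐ[ℂ] part (Superspace p r) ᵍ⊗[ℂ] part (A p),
      ∀ m, φ (Superspace.z p r m) = ∑ m', Superspace.z p r m' ᵍ⊗ₜ[ℂ] A.T p m' m := by
  have hp4 : p ^ 4 ≠ 1 := fun h => hp (by rw [show 16 = 4 * 4 from rfl, pow_mul, h, one_pow])
  have hp2 : p ^ 2 ≠ 1 := fun h => hp (by rw [show 16 = 2 * 8 from rfl, pow_mul, h, one_pow])
  have h0 : (p : ℂ)⁻¹ + p ≠ 0 := inv_add_self_ne_zero hp4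
  exact ⟨fun _ => isCoupledZero_iff hp2, fun _ => isCoupledOne_iff hp,
    freeCoaction_composite_cgZero, freeCoaction_composite_cgOne,
    consistent_iff hp4 r hξ, reorderingConsistent_relators_iff hp4 r hξ,
    hasOrderedBasis_relators_iff hp4 r hξ,
    composite_eq_iff_isSuperspace h0 r,
    Superspace.lift _ (isSuperspace_coaction h0 r), Superspace.lift_z _ _⟩

open OSpq OSpq.SuperAlgebra GradedTensorProduct TensorProduct in
theorem mainTheorem3 {Λ : Type*} [Ring Λ] [Algebra ℂ Λ] [SuperAlgebra Λ]
    (hΛ : IsSupercommutative Λ) (p : ℂˣ) (hp : ∀ n : ℕ, 0 < n → p ^ n ≠ 1) (r : ℂ) (ξ : Λ)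
    (hξ : parity ξ = -ξ) :
    -- the `L = 0` and `L = 1` components of the tensor square
    (∀ C, IsCoupledZero p C ↔ ∃ c : ℂ, C = c • cgZero p) ∧
    (∀ C, IsCoupledOne p C ↔ ∃ c : ℂ, C = c • cgOne p) ∧
    -- covariance of the composites
    freeCoaction p (composite (cgZero p) (FreeAlgebra.ι ℂ)) =
      composite (cgZero p) (FreeAlgebra.ι ℂ) ᵍ⊗ₜ[ℂ] 1 ∧
    (∀ M, freeCoaction p (composite (cgOne p M) (FreeAlgebra.ι ℂ)) =
      ∑ M', composite (cgOne p M') (FreeAlgebra.ι ℂ) ᵍ⊗ₜ[ℂ] A.T' p M' M) ∧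
    -- consistency
    (Consistent p r ξ ↔ ξ = 0) ∧
    (ReorderingConsistent (relators p r ξ) ↔ ξ = 0) ∧
    (Space.HasOrderedBasis (relators p r ξ) ↔ ξ = 0) ∧
    -- the relations of the covariant algebra
    (∀ {B : Type*} [Ring B] [Algebra ℂ B] (z : SignType → B),
      (composite (cgZero p) z = algebraMap ℂ B r ∧ ∀ M, composite (cgOne p M) z = 0) ↔
        IsSuperspace p r z) ∧
    -- covariance of the algebra
    ∃ φ : Superspace p r →ₐ[ℂ] part (Superspace p r) ᵍ⊗[ℂ] part (A p),
      ∀ m, φ (Superspace.z p r m) = ∑ m', Superspace.z p r m' ᵍ⊗ₜ[ℂ] A.T p m' m :=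
  mainTheorem3_general (hp 16 (by norm_num)) r hξ
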